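/- Let $\mathbb{K}$ be the ordered field of absolutely convergent generalized real Puiseux series, i.e. series $\boldsymbol z=\sum_{\alpha\in\mathbb{R}} c_\alpha t^\alpha$ with real coefficients, having only finitely many exponents above any given real number and converging absolutely for all large $t$; $\boldsymbol z>0$ means that the leading coefficient (that of the largest exponent) is positive. Let $\operatorname{val}\boldsymbol z\in\mathbb{T}=\mathbb{R}\cup\{-\infty\}$ be the largest exponent of $\boldsymbol z$ ($-\infty$ if $\boldsymbol z=0$), applied entrywise to vectors, and let $\boldsymbol z(t)$ be the value of the series at $t$. Let $\boldsymbol{\mathcal P}=\{\boldsymbol x\in\mathbb{K}^n : \boldsymbol A\boldsymbol x\le \boldsymbol b\}$ be a polyhedron over $\mathbb{K}$, with $\boldsymbol A\in\mathbb{K}^{m\times n}$, $\boldsymbol b\in\mathbb{K}^m$, put $\boldsymbol{\mathcal P}(t)=\{x\in\mathbb{R}^n:\boldsymbol A(t)x\le\boldsymbol b(t)\}$, and let $\boldsymbol c\in\mathbb{K}^n$. Assume that (i) $\boldsymbol{\mathcal P}\subset\mathbb{K}_{\ge0}^n$ and $0\in\boldsymbol{\mathcal P}$; (ii) $\operatorname{val}\boldsymbol{\mathcal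 P}\subset\mathbb{T}^n$ equals the closure of its interior; (iii) all entries of $\boldsymbol c$ are positive. For $\mathcal P\subset\mathbb{R}^n$ let $f_{\mathcal P}(\theta)=\log\int_{\mathcal P}e^{\langle\theta,x\rangle}dx$ and let $f^*_{\mathcal P}$ be its Fenchel conjugate (the entropic barrier). Then: 1. There is a function $X:\mathbb{R}\to\mathbb{R}^n$ (the tropical entropic central path) such that for every $\boldsymbol\mu\in\mathbb{K}_{>0}$ and all sufficiently large $t$, the problem of minimizing $\langle \boldsymbol c(t),x\rangle+\boldsymbol\mu(t)f^*_{\boldsymbol{\mathcal P}(t)}(x)$ over $x\in\operatorname{int}\boldsymbol{\mathcal P}(t)$ has a unique optimal solution $\mathcal C_t$, and $\lim_{t\to+\infty}\log_t \mathcal C_t=X(\operatorname{val}\boldsymbol\mu)$ entrywise. 2. $X$ is a continuous piecewise linear function with finitely many pieces. 3. $X$ coincides with the projection onto the $x$-coordinates of the tropical logarithmic (primal-dual) central path. That is, for every representation $\boldsymbol{\mathcal P}=\{\boldsymbol x\in\mathbb{K}_{\ge0}^n:\boldsymbol A'\boldsymbol x\le\boldsymbol b'\}$, with $\boldsymbol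 A'\in\mathbb{K}^{k\times n}$ and $\boldsymbol b'\in\mathbb{K}^k$, that does not contain the trivial inequality $0\le 0$ (no row of $(\boldsymbol A'\mid\boldsymbol b')$ is zero), there is a function $Z=(Z_x,Z_w,Z_s,Z_y):\mathbb{R}\to\mathbb{R}^n\times\mathbb{R}^k\times\mathbb{R}^n\times\mathbb{R}^k$ such that for every $\boldsymbol\mu\in\mathbb{K}_{>0}$ and all sufficiently large $t$, the system $$\boldsymbol A'(t)x+w=\boldsymbol b'(t),\quad s-\boldsymbol A'(t)^{\top}y=\boldsymbol c(t),\quad x_js_j=\boldsymbol\mu(t),\quad w_iy_i=\boldsymbol\mu(t),\quad x,w,s,y>0\qquad(j\in[n],\ i\in[k])$$ has a unique solution $(x,w,s,y)$, whose entrywise base-$t$ logarithm tends to $Z(\operatorname{val}\boldsymbol\mu)$ as $t\to+\infty$; and $Z_x(\lambda)=X(\lambda)$ for all $\lambda\in\mathbb{R}$. -/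

import Mathlib

/-! ### Absolutely convergent generalized real Puiseux series

The series `∑ c_α t ^ α` is stored as the Hahn series whose coefficient at `g` is `c_{-g}`, so that
decreasing exponents of `t` become increasing indices. `Lex (HahnSeries ℝ ℝ)` is a linearly ordered
field in Mathlib, a nonzero series being positive iff its leading coefficient (that of the largest
exponent of `t`) is positive. -/

/-- `z` is an absolutely convergent generalized Puiseux series: only finitely many of its exponents
lie above any given real number, and the series converges absolutely for all large `t`. -/
def IsAbsConvPuiseux (z : Lex (HahnSeries ℝ ℝ)) : Prop :=
  (∀ a : ℝ, ((ofLex z).support ∩ Set.Iic a).Finite) ∧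
    ∀ᶠ t : ℝ in Filter.atTop, Summable fun g : ℝ => |(ofLex z).coeff g| * t ^ (-g)

theorem IsAbsConvPuiseux.zero : IsAbsConvPuiseux 0 :=
  ⟨fun a => by simp, by simp [summable_zero]⟩

theorem IsAbsConvPuiseux.one : IsAbsConvPuiseux 1 := by
  refine ⟨fun a => ?_, Filter.Eventually.of_forall fun t => ?_⟩
  · refine (Set.finite_singleton (0 : ℝ)).subset ?_
    rintro g ⟨hg, -⟩
    by_contra h
    exact hg (HahnSeries.coeff_single_of_ne (r := (1 : ℝ)) h)
  · refine summable_of_ne_finset_zero (s := {0}) fun g hg => ?_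
    have h : (ofLex (1 : Lex (HahnSeries ℝ ℝ))).coeff g = 0 :=
      HahnSeries.coeff_single_of_ne (r := (1 : ℝ)) (by simpa using hg)
    rw [h, abs_zero, zero_mul]

theorem IsAbsConvPuiseux.neg {x : Lex (HahnSeries ℝ ℝ)} (hx : IsAbsConvPuiseux x) :
    IsAbsConvPuiseux (-x) := by
  refine ⟨fun a => ?_, ?_⟩
  · simpa using hx.1 a
  · simpa using hx.2

theorem IsAbsConvPuiseux.add {x y : Lex (HahnSeries ℝ ℝ)} (hx : IsAbsConvPuiseux x)
    (hy : IsAbsConvPuiseux y) : IsAbsConvPuiseux (x + y) := by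
  refine ⟨fun a => ((hx.1 a).union (hy.1 a)).subset ?_, ?_⟩
  · rintro g ⟨hg, hga⟩
    rcases HahnSeries.support_add_subset _ _ hg with h | h
    · exact Or.inl ⟨h, hga⟩
    · exact Or.inr ⟨h, hga⟩
  · filter_upwards [hx.2, hy.2, Filter.eventually_gt_atTop 0] with t h1 h2 ht
    refine Summable.of_nonneg_of_le (fun g => by positivity) (fun g => ?_) (h1.add h2)
    rw [← add_mul]
    exact mul_le_mul_of_nonneg_right (by simpa using abs_add_le _ _) (by positivity)

theorem IsAbsConvPuiseux.mul {x y : Lex (HahnSeries ℝ ℝ)} (hx : IsAbsConvPuiseux x)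
    (hy : IsAbsConvPuiseux y) : IsAbsConvPuiseux (x * y) := by
  refine ⟨fun a => ?_, ?_⟩
  · refine (((hx.1 (a - (ofLex y).order)).prod (hy.1 (a - (ofLex x).order))).image
      (fun p : ℝ × ℝ => p.1 + p.2)).subset ?_
    rintro g ⟨hg, hga⟩
    obtain ⟨i, hi, j, hj, rfl⟩ := HahnSeries.support_mul_subset hg
    have h1 : (ofLex x).order ≤ i := HahnSeries.order_le_of_coeff_ne_zero hi
    have h2 : (ofLex y).order ≤ j := HahnSeries.order_le_of_coeff_ne_zero hj
    have h3 : i + j ≤ a := hga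
    refine ⟨(i, j), ⟨⟨hi, ?_⟩, ⟨hj, ?_⟩⟩, rfl⟩
    · simp only [Set.mem_Iic]; linarith
    · simp only [Set.mem_Iic]; linarith
  · filter_upwards [hx.2, hy.2, Filter.eventually_gt_atTop 0] with t h1 h2 ht
    have hF := h1.mul_of_nonneg h2 (fun g => by positivity) (fun g => by positivity)
    have hS := (Equiv.sigmaFiberEquiv (fun p : ℝ × ℝ => p.1 + p.2)).summable_iff.mpr hF
    refine Summable.of_nonneg_of_le (fun g => by positivity) (fun g => ?_) hS.sigma
    have hg := hS.sigma_factor g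
    set s := Finset.antidiagonal (ofLex x).isPWO_support (ofLex y).isPWO_support g with hs
    have hmem : ∀ p ∈ s, p.1 + p.2 = g := fun p hp => (Finset.mem_antidiagonal.mp hp).2.2
    have hle := hg.sum_le_tsum (s.subtype fun p : ℝ × ℝ => p.1 + p.2 = g)
      (fun p _ => by simp only [Function.comp]; positivity)
    refine le_trans ?_ hle
    have hco : (ofLex (x * y)).coeff g
        = ∑ p ∈ s, (ofLex x).coeff p.1 * (ofLex y).coeff p.2 := HahnSeries.coeff_mul
    rw [hco]
    calc |∑ p ∈ s, (ofLex x).coeff p.1 * (ofLex y).coeff p.2| * t ^ (-g)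
        ≤ (∑ p ∈ s, |(ofLex x).coeff p.1 * (ofLex y).coeff p.2|) * t ^ (-g) :=
          mul_le_mul_of_nonneg_right (Finset.abs_sum_le_sum_abs _ _) (by positivity)
      _ = ∑ p ∈ s, |(ofLex x).coeff p.1| * t ^ (-p.1) * (|(ofLex y).coeff p.2| * t ^ (-p.2)) := by
          rw [Finset.sum_mul]
          refine Finset.sum_congr rfl fun p hp => ?_
          rw [← hmem p hp, neg_add, Real.rpow_add ht, abs_mul]
          ring
      _ = _ := by
          rw [← Finset.sum_subtype_of_mem _ hmem]
          rfl
      _ ≤ _ := le_rfl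

/-- The field `𝕂` of absolutely convergent generalized real Puiseux series, with the ring operations
and the linear order inherited from the Hahn series. -/
def puiseuxSubring : Subring (Lex (HahnSeries ℝ ℝ)) where
  carrier := {z | IsAbsConvPuiseux z}
  zero_mem' := IsAbsConvPuiseux.zero
  one_mem' := IsAbsConvPuiseux.one
  add_mem' := IsAbsConvPuiseux.add
  mul_mem' := IsAbsConvPuiseux.mul
  neg_mem' := IsAbsConvPuiseux.neg

/-- Absolutely convergent generalized real Puiseux series. -/
abbrev Puiseux : Type := puiseuxSubring

noncomputable section

namespace Puiseux

/-- The valuation: the largest exponent of `t` in the support, `⊥ = -∞` for the zero series. -/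
def val (z : Puiseux) : WithBot ℝ :=
  open Classical in if z = 0 then ⊥ else ((-(ofLex z.1).order : ℝ) : WithBot ℝ)

/-- The value `z(t)` of the series at a real number `t`. -/
def eval (t : ℝ) (z : Puiseux) : ℝ :=
  ∑' g : ℝ, (ofLex z.1).coeff g * t ^ (-g)

end Puiseux

open Matrix in
/-- The polyhedron `{x : A x ≤ b}`, over `ℝ` or over Puiseux series. -/
def polyhedron {R : Type*} [Ring R] [LE R] {m n : ℕ} (A : Matrix (Fin m) (Fin n) R)
    (b : Fin m → R) : Set (Fin n → R) :=
  {x | A *ᵥ x ≤ b}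

/-- The real polyhedron `𝒫(t) = {x : A(t) x ≤ b(t)}`. -/
def polyhedronAt {m n : ℕ} (A : Matrix (Fin m) (Fin n) Puiseux) (b : Fin m → Puiseux) (t : ℝ) :
    Set (Fin n → ℝ) :=
  polyhedron (A.map (Puiseux.eval t)) (fun i => Puiseux.eval t (b i))

/-- The standing assumption on a polyhedron `P` over Puiseux series and an objective vector `c`.
The tropical space `𝕋ⁿ = (ℝ ∪ {-∞})ⁿ` carries the product of the order topologies. -/
structure TropAssumption {n : ℕ} (P : Set (Fin n → Puiseux)) (c : Fin n → Puiseux) : Prop where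
  nonneg : ∀ x ∈ P, 0 ≤ x
  zero_mem : 0 ∈ P
  regular : (fun (x : Fin n → Puiseux) i => (x i).val) '' P =
    closure (interior ((fun (x : Fin n → Puiseux) i => (x i).val) '' P))
  obj_pos : ∀ i, 0 < c i

/-! ### The entropic central path -/

/-- The logarithmic Laplace transform `f_P(θ) = log ∫_P e^⟨θ,x⟩ dx` (possibly infinite). -/
def logLaplace {n : ℕ} (P : Set (Fin n → ℝ)) (θ : Fin n → ℝ) : EReal :=
  ENNReal.log (∫⁻ x in P, ENNReal.ofReal (Real.exp (θ ⬝ᵥ x)))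

/-- The entropic barrier on `P`: the Fenchel conjugate of `logLaplace P`. -/
def entropicBarrier {n : ℕ} (P : Set (Fin n → ℝ)) (x : Fin n → ℝ) : EReal :=
  ⨆ θ : Fin n → ℝ, ((θ ⬝ᵥ x : ℝ) : EReal) - logLaplace P θ

/-- `x` is an optimal solution of: minimize `⟨c,x⟩ + μ f*_P(x)` subject to `x ∈ interior P`. -/
def IsEntropicCentralPoint {n : ℕ} (P : Set (Fin n → ℝ)) (c : Fin n → ℝ) (μ : ℝ)
    (x : Fin n → ℝ) : Prop :=
  x ∈ interior P ∧
    IsMinOn (fun y : Fin n → ℝ => ((c ⬝ᵥ y : ℝ) : EReal) + (μ : EReal) * entropicBarrier P y)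
      (interior P) x

/-- `X` is the tropical entropic central path of the linear programs: minimize `⟨c(t),x⟩` subject to
`A(t) x ≤ b(t)`. For every positive series `μ` with valuation `lam`, the entropic central path of
the program at `t` has exactly one point with parameter `μ(t)` once `t` is large, and the entrywise
base-`t` logarithm of this point tends to `X lam` as `t → +∞`. -/
def IsTropicalEntropicPath {m n : ℕ} (A : Matrix (Fin m) (Fin n) Puiseux) (b : Fin m → Puiseux)
    (c : Fin n → Puiseux) (X : ℝ → Fin n → ℝ) : Prop :=
  ∀ (lam : ℝ) (μ : Puiseux), 0 < μ → μ.val = (lam : WithBot ℝ) →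
    (∀ᶠ t in Filter.atTop, ∃! x : Fin n → ℝ,
      IsEntropicCentralPoint (polyhedronAt A b t) (fun j => (c j).eval t) (μ.eval t) x) ∧
    ∀ C : ℝ → Fin n → ℝ,
      (∀ᶠ t in Filter.atTop,
        IsEntropicCentralPoint (polyhedronAt A b t) (fun j => (c j).eval t) (μ.eval t) (C t)) →
      ∀ j, Filter.Tendsto (fun t => Real.logb t (C t j)) Filter.atTop (nhds (X lam j))

/-! ### The logarithmic primal-dual central path -/

/-- Quadruples `(x, w, s, y)`: primal variables, primal slacks, dual slacks, dual variables. -/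
structure PrimalDual (m n : ℕ) where
  x : Fin n → ℝ
  w : Fin m → ℝ
  s : Fin n → ℝ
  y : Fin m → ℝ

open Matrix in
/-- The system defining the point with parameter `μ` of the logarithmic primal-dual central path of
the program: minimize `⟨c,x⟩` subject to `A x + w = b`, `x ≥ 0`, `w ≥ 0`. -/
structure IsLogCentralPoint {m n : ℕ} (A : Matrix (Fin m) (Fin n) ℝ) (b : Fin m → ℝ)
    (c : Fin n → ℝ) (μ : ℝ) (z : PrimalDual m n) : Prop where
  primal : A *ᵥ z.x + z.w = b
  dual : z.s - Aᵀ *ᵥ z.y = c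
  compl_x : ∀ j, z.x j * z.s j = μ
  compl_w : ∀ i, z.w i * z.y i = μ
  x_pos : ∀ j, 0 < z.x j
  w_pos : ∀ i, 0 < z.w i
  s_pos : ∀ j, 0 < z.s j
  y_pos : ∀ i, 0 < z.y i

/-- `Z` is the tropical logarithmic (primal-dual) central path of the linear programs: minimize
`⟨c(t),x⟩` subject to `A(t) x ≤ b(t)`, `x ≥ 0`, that is, the entrywise log-limit of their
logarithmic central paths, in the same sense as for the entropic one. -/
def IsTropicalLogPath {m n : ℕ} (A : Matrix (Fin m) (Fin n) Puiseux) (b : Fin m → Puiseux)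
    (c : Fin n → Puiseux) (Z : ℝ → PrimalDual m n) : Prop :=
  ∀ (lam : ℝ) (μ : Puiseux), 0 < μ → μ.val = (lam : WithBot ℝ) →
    (∀ᶠ t in Filter.atTop, ∃! z : PrimalDual m n,
      IsLogCentralPoint (A.map (Puiseux.eval t)) (fun i => (b i).eval t)
        (fun j => (c j).eval t) (μ.eval t) z) ∧
    ∀ C : ℝ → PrimalDual m n,
      (∀ᶠ t in Filter.atTop,
        IsLogCentralPoint (A.map (Puiseux.eval t)) (fun i => (b i).eval t)
          (fun j => (c j).eval t) (μ.eval t) (C t)) →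
      (∀ j, Filter.Tendsto (fun t => Real.logb t ((C t).x j)) Filter.atTop
        (nhds ((Z lam).x j))) ∧
      (∀ i, Filter.Tendsto (fun t => Real.logb t ((C t).w i)) Filter.atTop
        (nhds ((Z lam).w i))) ∧
      (∀ j, Filter.Tendsto (fun t => Real.logb t ((C t).s j)) Filter.atTop
        (nhds ((Z lam).s j))) ∧
      (∀ i, Filter.Tendsto (fun t => Real.logb t ((C t).y i)) Filter.atTop
        (nhds ((Z lam).y i)))

/-- `f` is continuous and piecewise linear with finitely many pieces: it is affine on every interval
that avoids a finite set of breakpoints. -/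
def IsPiecewiseLinear {n : ℕ} (f : ℝ → Fin n → ℝ) : Prop :=
  Continuous f ∧ ∃ B : Finset ℝ, ∀ I : Set ℝ, I.OrdConnected → Disjoint I (B : Set ℝ) →
    ∃ u v : Fin n → ℝ, ∀ r ∈ I, f r = r • u + v

end

open Filter Topology Matrix

/-! ### Evaluation of Puiseux series at large real numbers -/

/-! Both central paths are governed by the same quantity. For a coordinate `j`, let `M_j(μ)` be the
maximum of `x_j` over the sublevel set `{x ∈ P : ⟨c,x⟩ ≤ μ}`. For large `t`, the `j`-th coordinate
of either central point with parameter `μ(t)` equals `M_j(μ)(t)` up to a factor depending only on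
the dimensions. Constants vanish under `log_t`, so both paths have the same log-limit, the exponent
of `M_j(μ)`.

The comparison has two halves. A central point has cost at most `κ μ`, so shrinking it by `κ`
towards the origin, which lies in `P`, brings it into the sublevel set
(`le_mul_of_isGreatest_sublevel`). Conversely, `κ` times the central point dominates every point of
the sublevel set coordinatewise. For the logarithmic path both halves come from the duality gap,
with `κ = n + k + 1` (`IsLogCentralPoint.dotProduct_le`, `IsLogCentralPoint.le_mul`). The entropic
point is the mean of the density proportional to `exp(-⟨c,x⟩/μ)` on `P`
(`isEntropicCentralPoint_iff`), and both halves come from contracting `P` by one half towards one of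
its points, with `κ = 2 ^ (n + 2)` (`gibbsMean_bounds`).

The shape of the limit comes from linear programming over the ordered field of series
(`exists_tropical_value`). Fourier–Motzkin elimination yields finitely many dual solutions that
serve all `μ` at once, so `M_j(μ)` is always one of finitely many expressions `p + q μ` with `p, q ≥
0`, and its exponent is an affine function of slope 0 or 1 in the exponent of `μ`. As `0 ∈ P`,
`M_j(μ)` is nondecreasing and `M_j(μ)/μ` nonincreasing, which makes the exponent 1-Lipschitz. Dual
certificates remain valid for large `t`; this carries maxima and changes of representation over to
the reals. The same argument for slacks gives `w`, and complementarity gives `s` and `y`.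

Regularity of `val P` enters only through strict feasibility: a nonempty interior keeps `P` out of
every hyperplane (`exists_dotProduct_ne_zero`). -/

theorem tendsto_tsum_mul_rpow {f : ℝ → ℝ} {g₀ T : ℝ} (hf : ∀ g < g₀, f g = 0)
    (hT : 0 < T) (hs : Summable fun g => |f g| * T ^ (-g)) :
    Tendsto (fun t : ℝ => (∑' g, f g * t ^ (-g)) * t ^ g₀) atTop (𝓝 (f g₀)) := by
  have h1 : Tendsto (fun t : ℝ => ∑' g, f g * t ^ (g₀ - g)) atTop
      (𝓝 (∑' g, if g = g₀ then f g₀ else 0)) := by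
    -- Only indices `g ≥ g₀` matter, and there `t ^ (g₀ - g)` decreases in `t`, so the terms at `T`
    -- dominate.
    refine tendsto_tsum_of_dominated_convergence (bound := fun g => |f g| * T ^ (-g) * T ^ g₀)
      (hs.mul_right _) (fun g => ?_) ?_
    · rcases lt_trichotomy g g₀ with h | h | h
      · simp [hf g h, h.ne]
      · simp [h]
      · have h2 : Tendsto (fun t : ℝ => t ^ (g₀ - g)) atTop (𝓝 0) := by
          simpa using tendsto_rpow_neg_atTop (sub_pos.2 h)
        simpa [h.ne'] using h2.const_mul (f g)
    · filter_upwards [eventually_ge_atTop T] with t ht g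
      have ht0 : 0 < t := hT.trans_le ht
      rcases lt_or_ge g g₀ with h | h
      · simp [hf g h]
      · rw [norm_mul, Real.norm_eq_abs, Real.norm_eq_abs,
          abs_of_pos (Real.rpow_pos_of_pos ht0 _), mul_assoc, ← Real.rpow_add hT, neg_add_eq_sub]
        exact mul_le_mul_of_nonneg_left
          (Real.rpow_le_rpow_of_nonpos hT ht (by linarith)) (abs_nonneg _)
  rw [tsum_ite_eq] at h1
  refine h1.congr' ?_
  filter_upwards [eventually_gt_atTop 0] with t ht
  rw [← tsum_mul_right]
  refine tsum_congr fun g => ?_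
  rw [mul_assoc, ← Real.rpow_add ht, neg_add_eq_sub]

namespace Puiseux

theorem summable_of_abs {z : Lex (HahnSeries ℝ ℝ)} {t : ℝ} (ht : 0 < t)
    (h : Summable fun g : ℝ => |(ofLex z).coeff g| * t ^ (-g)) :
    Summable fun g : ℝ => (ofLex z).coeff g * t ^ (-g) := by
  refine Summable.of_norm ?_
  refine h.congr fun g => ?_
  rw [norm_mul, Real.norm_eq_abs, Real.norm_eq_abs, abs_of_pos (Real.rpow_pos_of_pos ht _)]

theorem eventually_summable (z : Puiseux) :
    ∀ᶠ t : ℝ in atTop, Summable fun g : ℝ => (ofLex z.1).coeff g * t ^ (-g) := by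
  filter_upwards [z.2.2, eventually_gt_atTop 0] with t h ht
  exact summable_of_abs ht h

theorem eval_zero (t : ℝ) : eval t 0 = 0 := by simp [eval]

theorem eval_one (t : ℝ) : eval t 1 = 1 := by
  unfold eval
  rw [tsum_eq_single 0]
  · simp
  · intro g hg
    have h : (ofLex (1 : Puiseux).1).coeff g = 0 :=
      HahnSeries.coeff_single_of_ne (r := (1 : ℝ)) hg
    rw [h, zero_mul]

theorem eval_neg (t : ℝ) (x : Puiseux) : eval t (-x) = -eval t x := by
  simp [eval, tsum_neg]

theorem eventually_eval_add (x y : Puiseux) :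
    ∀ᶠ t in atTop, eval t (x + y) = eval t x + eval t y := by
  filter_upwards [eventually_summable x, eventually_summable y] with t hx hy
  unfold eval
  rw [← hx.tsum_add hy]
  exact tsum_congr fun g => by simp [add_mul]

/-- Absolute convergence allows the double sum to be regrouped along the fibres `i + j = g`; on each
fibre only the finitely many pairs in the two supports contribute, and they give the Cauchy
coefficient. -/
theorem eventually_eval_mul (x y : Puiseux) :
    ∀ᶠ t in atTop, eval t (x * y) = eval t x * eval t y := by
  filter_upwards [x.2.2, y.2.2, eventually_gt_atTop 0] with t hx hy ht
  have hx' := summable_of_abs ht hx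
  have hy' := summable_of_abs ht hy
  unfold eval
  rw [tsum_mul_tsum_of_summable_norm hx'.norm hy'.norm]
  have hF := summable_mul_of_summable_norm hx'.norm hy'.norm
  have hS := (Equiv.sigmaFiberEquiv (fun p : ℝ × ℝ => p.1 + p.2)).summable_iff.mpr hF
  rw [← (Equiv.sigmaFiberEquiv (fun p : ℝ × ℝ => p.1 + p.2)).tsum_eq]
  refine Eq.trans ?_ hS.tsum_sigma.symm
  refine tsum_congr fun g => ?_
  set s := Finset.antidiagonal (ofLex x.1).isPWO_support (ofLex y.1).isPWO_support g with hs
  have hmem : ∀ p ∈ s, p.1 + p.2 = g := fun p hp => (Finset.mem_antidiagonal.mp hp).2.2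
  rw [tsum_eq_sum (s := s.subtype fun p : ℝ × ℝ => p.1 + p.2 = g)]
  · have hco : (ofLex (x * y).1).coeff g
        = ∑ p ∈ s, (ofLex x.1).coeff p.1 * (ofLex y.1).coeff p.2 := HahnSeries.coeff_mul
    rw [hco, Finset.sum_mul]
    trans ∑ p ∈ s, (ofLex x.1).coeff p.1 * t ^ (-p.1) * ((ofLex y.1).coeff p.2 * t ^ (-p.2))
    · refine Finset.sum_congr rfl fun p hp => ?_
      rw [← hmem p hp, neg_add, Real.rpow_add ht]
      ring
    · rw [← Finset.sum_subtype_of_mem _ hmem]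
      rfl
  · rintro ⟨p, hp⟩ hps
    simp only [Finset.mem_subtype, hs, Finset.mem_antidiagonal, HahnSeries.mem_support] at hps
    have : (ofLex x.1).coeff p.1 = 0 ∨ (ofLex y.1).coeff p.2 = 0 := by
      by_contra h
      push Not at h
      exact hps ⟨h.1, h.2, hp⟩
    show (ofLex x.1).coeff p.1 * t ^ (-p.1) * ((ofLex y.1).coeff p.2 * t ^ (-p.2)) = 0
    rcases this with h | h <;> simp [h]

theorem eventually_eval_sub (x y : Puiseux) :
    ∀ᶠ t in atTop, eval t (x - y) = eval t x - eval t y := by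
  filter_upwards [eventually_eval_add x (-y)] with t h
  rw [sub_eq_add_neg, h, eval_neg, sub_eq_add_neg]

theorem eventually_eval_sum {ι : Type*} (s : Finset ι) (f : ι → Puiseux) :
    ∀ᶠ t in atTop, eval t (∑ i ∈ s, f i) = ∑ i ∈ s, eval t (f i) := by
  classical
  induction s using Finset.induction_on with
  | empty => simp [eval_zero]
  | insert a s ha ih =>
    filter_upwards [ih, eventually_eval_add (f a) (∑ i ∈ s, f i)] with t h1 h2
    rw [Finset.sum_insert ha, Finset.sum_insert ha, h2, h1]

theorem eventually_eval_dotProduct {ι : Type*} [Fintype ι] (u v : ι → Puiseux) :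
    ∀ᶠ t in atTop, eval t (u ⬝ᵥ v) = (fun i => eval t (u i)) ⬝ᵥ fun i => eval t (v i) := by
  filter_upwards [eventually_eval_sum Finset.univ fun i => u i * v i,
    eventually_all.2 fun i => eventually_eval_mul (u i) (v i)] with t h1 h2
  rw [dotProduct, h1, dotProduct]
  exact Finset.sum_congr rfl fun i _ => h2 i

/-- The largest exponent of `z`, as a real number (`0` for `z = 0`). -/
noncomputable def exponent (z : Puiseux) : ℝ := -(ofLex z.1).order

theorem val_eq_exponent {z : Puiseux} (hz : z ≠ 0) : z.val = (exponent z : WithBot ℝ) := by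
  simp [val, hz, exponent]

theorem val_eq_coe_iff {z : Puiseux} {r : ℝ} :
    z.val = (r : WithBot ℝ) ↔ z ≠ 0 ∧ exponent z = r := by
  by_cases hz : z = 0
  · simp [val, hz]
  · rw [val_eq_exponent hz]
    simp [hz]

theorem tendsto_eval_mul_rpow (z : Puiseux) :
    Tendsto (fun t : ℝ => eval t z * t ^ (-exponent z)) atTop
      (𝓝 (ofLex z.1).leadingCoeff) := by
  obtain ⟨T, hT, hT0⟩ := (z.2.2.and (eventually_gt_atTop 0)).exists
  rw [HahnSeries.leadingCoeff_eq]
  have := tendsto_tsum_mul_rpow (f := (ofLex z.1).coeff) (g₀ := (ofLex z.1).order)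
    (fun g hg => HahnSeries.coeff_eq_zero_of_lt_order hg) hT0 hT
  simpa [exponent, eval] using this

theorem leadingCoeff_pos {z : Puiseux} (hz : 0 < z) : 0 < (ofLex z.1).leadingCoeff :=
  HahnSeries.leadingCoeff_pos_iff.2 hz

/-- After division by the leading power of `t` the value tends to the leading coefficient. This is
how order relations between series pass to large `t`. -/
theorem eventually_eval_pos {z : Puiseux} (hz : 0 < z) : ∀ᶠ t in atTop, 0 < eval t z := by
  filter_upwards [(tendsto_eval_mul_rpow z).eventually (lt_mem_nhds (leadingCoeff_pos hz)),
    eventually_gt_atTop 0] with t h ht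
  exact pos_of_mul_pos_left h (Real.rpow_pos_of_pos ht _).le

theorem eventually_eval_nonneg {z : Puiseux} (hz : 0 ≤ z) : ∀ᶠ t in atTop, 0 ≤ eval t z := by
  rcases hz.eq_or_lt with h | h
  · exact Eventually.of_forall fun t => by rw [← h, eval_zero]
  · exact (eventually_eval_pos h).mono fun t ht => ht.le

theorem eventually_eval_le {x y : Puiseux} (h : x ≤ y) :
    ∀ᶠ t in atTop, eval t x ≤ eval t y := by
  filter_upwards [eventually_eval_nonneg (sub_nonneg.2 h), eventually_eval_sub y x] with t h1 h2
  linarith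

theorem eventually_eval_lt {x y : Puiseux} (h : x < y) :
    ∀ᶠ t in atTop, eval t x < eval t y := by
  filter_upwards [eventually_eval_pos (sub_pos.2 h), eventually_eval_sub y x] with t h1 h2
  linarith

theorem tendsto_logb_of_mul_rpow {f : ℝ → ℝ} {e a : ℝ} (ha : 0 < a)
    (hf : Tendsto (fun t : ℝ => f t * t ^ (-e)) atTop (𝓝 a)) :
    Tendsto (fun t => Real.logb t (f t)) atTop (𝓝 e) := by
  have h1 : Tendsto (fun t : ℝ => Real.log (f t * t ^ (-e)) / Real.log t + e) atTop
      (𝓝 (0 + e)) := by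
    refine Tendsto.add_const e ?_
    exact ((Real.continuousAt_log ha.ne').tendsto.comp hf).div_atTop Real.tendsto_log_atTop
  rw [zero_add] at h1
  refine h1.congr' ?_
  filter_upwards [hf.eventually (lt_mem_nhds ha), eventually_gt_atTop 1] with t h ht
  have ht0 : (0 : ℝ) < t := by linarith
  have hl : 0 < Real.log t := Real.log_pos ht
  have hp := Real.rpow_pos_of_pos ht0 (-e)
  rw [Real.log_mul (pos_of_mul_pos_left h hp.le).ne' hp.ne', Real.log_rpow ht0, Real.logb]
  field_simp
  ring

theorem tendsto_logb_eval {z : Puiseux} (hz : 0 < z) :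
    Tendsto (fun t => Real.logb t (eval t z)) atTop (𝓝 (exponent z)) :=
  tendsto_logb_of_mul_rpow (leadingCoeff_pos hz) (tendsto_eval_mul_rpow z)

/-- The exponent is the limit of `log_t` of the values, and these are ordered for large `t`. -/
theorem exponent_mono {x y : Puiseux} (hx : 0 < x) (h : x ≤ y) : exponent x ≤ exponent y := by
  refine le_of_tendsto_of_tendsto (tendsto_logb_eval hx) (tendsto_logb_eval (hx.trans_le h)) ?_
  filter_upwards [eventually_eval_pos hx, eventually_eval_le h, eventually_gt_atTop 1]
    with t h1 h2 ht
  exact Real.logb_le_logb_of_le ht h1 h2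

theorem exponent_mul {x y : Puiseux} (hx : x ≠ 0) (hy : y ≠ 0) :
    exponent (x * y) = exponent x + exponent y := by
  have hx' : ofLex x.1 ≠ 0 := fun h => hx (Subtype.ext h)
  have hy' : ofLex y.1 ≠ 0 := fun h => hy (Subtype.ext h)
  have : (ofLex (x * y).1).order = (ofLex x.1).order + (ofLex y.1).order :=
    HahnSeries.order_mul hx' hy'
  rw [exponent, this, exponent, exponent]
  ring

theorem lt_of_exponent_lt {x y : Puiseux} (hy : 0 < y) (h : exponent x < exponent y) : x < y := by
  by_contra hxy
  exact absurd (exponent_mono hy (not_lt.1 hxy)) (not_le.2 h)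

/-- The series `a t ^ r`. -/
noncomputable def monomial (r a : ℝ) : Puiseux :=
  ⟨toLex (HahnSeries.single (-r) a), by
    refine ⟨fun e => ?_, Eventually.of_forall fun t => ?_⟩
    · refine (Set.finite_singleton (-r)).subset ?_
      rintro g ⟨hg, -⟩
      by_contra h
      exact hg (HahnSeries.coeff_single_of_ne (r := a) h)
    · refine summable_of_ne_finset_zero (s := {-r}) fun g hg => ?_
      rw [ofLex_toLex, HahnSeries.coeff_single_of_ne (by simpa using hg), abs_zero, zero_mul]⟩

theorem monomial_pos {r a : ℝ} (ha : 0 < a) : 0 < monomial r a := by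
  refine HahnSeries.leadingCoeff_pos_iff.1 ?_
  simpa [monomial] using ha

theorem exponent_monomial {r a : ℝ} (ha : a ≠ 0) : exponent (monomial r a) = r := by
  simp [exponent, monomial, HahnSeries.order_single ha]

theorem monomial_zero_one : monomial 0 1 = 1 := by
  refine Subtype.ext ?_
  simp only [monomial, neg_zero]
  rfl

end Puiseux

/-! ### Inverses of Puiseux series -/

/-- Let `δ` be the gap between 0 and the rest of the support of `z`. By `z * z⁻¹ = 1`, a nonzero
exponent of `z⁻¹` is a sum of an exponent of `z` that is at least `δ` and an exponent of `z⁻¹`, so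
finiteness up to `a - δ` gives finiteness up to `a`. -/
theorem HahnSeries.finite_support_inv_inter_Iic {z : HahnSeries ℝ ℝ} (hz : z.coeff 0 = 1)
    (hord : z.order = 0) (hfin : ∀ a, (z.support ∩ Set.Iic a).Finite) (a : ℝ) :
    ((z⁻¹).support ∩ Set.Iic a).Finite := by
  have hz0 : z ≠ 0 := by rintro rfl; simp at hz
  have hinv : z * z⁻¹ = 1 := mul_inv_cancel₀ hz0
  have hord' : (z⁻¹).order = 0 := by
    have := HahnSeries.order_mul hz0 (inv_ne_zero hz0)
    rw [hinv, HahnSeries.order_one, hord] at this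
    linarith
  obtain ⟨δ, hδ, hδz⟩ : ∃ δ > 0, ∀ g ∈ z.support, g ≠ 0 → δ ≤ g := by
    rcases ((z.support ∩ Set.Iic 1) \ {0}).eq_empty_or_nonempty with he | hne
    · refine ⟨1, one_pos, fun g hg hg0 => ?_⟩
      by_contra h
      have : g ∈ (z.support ∩ Set.Iic 1) \ {0} := ⟨⟨hg, (not_le.1 h).le⟩, hg0⟩
      simp [he] at this
    · obtain ⟨d, hd, hmin⟩ := Set.exists_min_image _ id ((hfin 1).sdiff (t := {0})) hne
      have hd0 : 0 ≤ d := hord ▸ HahnSeries.order_le_of_coeff_ne_zero hd.1.1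
      refine ⟨d, lt_of_le_of_ne hd0 fun h => hd.2 h.symm, fun g hg hg0 => ?_⟩
      by_cases h : g ≤ 1
      · exact hmin g ⟨⟨hg, h⟩, hg0⟩
      · exact le_trans hd.1.2 (not_le.1 h).le
  have key : ∀ (N : ℕ) (a : ℝ), a < N * δ → ((z⁻¹).support ∩ Set.Iic a).Finite := by
    intro N
    induction N with
    | zero =>
      intro a ha
      convert Set.finite_empty
      refine Set.eq_empty_of_forall_notMem fun g ⟨hg, hga⟩ => ?_
      have h1 := HahnSeries.order_le_of_coeff_ne_zero hg
      rw [hord'] at h1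
      simp only [Nat.cast_zero, zero_mul] at ha
      exact absurd (lt_of_le_of_lt hga ha) (not_lt.2 h1)
    | succ N ih =>
      intro a ha
      have ha' : a - δ < N * δ := by push_cast at ha; linarith
      refine ((Set.finite_singleton (0 : ℝ)).union
        ((((hfin a).prod (ih _ ha'))).image (fun p : ℝ × ℝ => p.1 + p.2))).subset ?_
      rintro g ⟨hg, hga⟩
      by_cases hg0 : g = 0
      · exact Or.inl hg0
      right
      have hsum : (z * z⁻¹).coeff g = 0 := by
        rw [hinv]; exact HahnSeries.coeff_single_of_ne (r := (1 : ℝ)) hg0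
      rw [HahnSeries.coeff_mul] at hsum
      have h0g : ((0 : ℝ), g) ∈
          Finset.antidiagonal z.isPWO_support (z⁻¹).isPWO_support g := by
        simp only [Finset.mem_antidiagonal, HahnSeries.mem_support, hz]
        exact ⟨one_ne_zero, hg, zero_add _⟩
      obtain ⟨p, hp, hpne⟩ : ∃ p ∈ Finset.antidiagonal z.isPWO_support
          (z⁻¹).isPWO_support g, p ≠ (0, g) := by
        by_contra hcon
        push Not at hcon
        rw [Finset.sum_eq_single_of_mem _ h0g fun p hp hne => absurd (hcon p hp) hne] at hsum
        simp only [hz, one_mul] at hsum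
        exact hg hsum
      obtain ⟨hp1, hp2, hp3⟩ := Finset.mem_antidiagonal.1 hp
      have hp10 : p.1 ≠ 0 := fun h => hpne (Prod.ext h (by simpa [h] using hp3))
      have h1 := hδz _ hp1 hp10
      have h2 := HahnSeries.order_le_of_coeff_ne_zero hp2
      rw [hord'] at h2
      have h3 : g ≤ a := hga
      refine ⟨p, ⟨⟨hp1, ?_⟩, ⟨hp2, ?_⟩⟩, hp3⟩
      · simp only [Set.mem_Iic]; linarith
      · simp only [Set.mem_Iic]; linarith
  obtain ⟨N, hN⟩ := exists_nat_gt (a / δ)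
  exact key N a ((div_lt_iff₀ hδ).1 hN)

/-- The recursion for the coefficients of `z⁻¹` bounds the truncated sum `S` by `1 + S / 2`, because
the terms of `z` other than the constant one weigh at most `1 / 2`. Truncation makes `S` finite, so
`S ≤ 2`, uniformly in `a`. -/
theorem HahnSeries.sum_abs_coeff_inv_le {z : HahnSeries ℝ ℝ} (hz : z.coeff 0 = 1)
    (hord : z.order = 0) (hfin : ∀ a, (z.support ∩ Set.Iic a).Finite) {t : ℝ} (ht : 0 < t)
    (hs : Summable fun g : ℝ => |z.coeff g| * t ^ (-g))
    (hle : ∑' g : ℝ, |z.coeff g| * t ^ (-g) ≤ 3 / 2) (a : ℝ) :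
    ∑ g ∈ (finite_support_inv_inter_Iic hz hord hfin a).toFinset,
      |(z⁻¹).coeff g| * t ^ (-g) ≤ 2 := by
  have hz0 : z ≠ 0 := by rintro rfl; simp at hz
  have hinv : z * z⁻¹ = 1 := mul_inv_cancel₀ hz0
  have hord' : (z⁻¹).order = 0 := by
    have := HahnSeries.order_mul hz0 (inv_ne_zero hz0)
    rw [hinv, HahnSeries.order_one, hord] at this
    linarith
  set F := (finite_support_inv_inter_Iic hz hord hfin a).toFinset with hF
  set G := (hfin a).toFinset.erase 0 with hG
  set h : ℝ × ℝ → ℝ := fun p => |z.coeff p.1| * t ^ (-p.1) * (|(z⁻¹).coeff p.2| * t ^ (-p.2))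
    with hh
  have hh0 : ∀ p, 0 ≤ h p := fun p => by positivity
  have hGle : ∑ g ∈ G, |z.coeff g| * t ^ (-g) ≤ 1 / 2 := by
    have h1 := hs.sum_le_tsum (insert 0 G) (fun g _ => by positivity)
    rw [Finset.sum_insert (by simp [hG]), hz] at h1
    simp only [abs_one, neg_zero, Real.rpow_zero, mul_one] at h1
    linarith
  have hterm : ∀ g ∈ F, |(z⁻¹).coeff g| * t ^ (-g)
      ≤ (if g = 0 then 1 else 0) + ∑ p ∈ (G ×ˢ F).filter (fun p => p.1 + p.2 = g), h p := by
    intro g hg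
    have hgF : g ∈ (z⁻¹).support ∧ g ≤ a := by simpa [hF] using hg
    have h0g : ((0 : ℝ), g) ∈
        Finset.antidiagonal z.isPWO_support (z⁻¹).isPWO_support g := by
      simp only [Finset.mem_antidiagonal, HahnSeries.mem_support, hz]
      exact ⟨one_ne_zero, hgF.1, zero_add _⟩
    have hsum : (z * z⁻¹).coeff g = if g = 0 then 1 else 0 := by
      rw [hinv]; exact HahnSeries.coeff_single (r := (1 : ℝ))
    rw [HahnSeries.coeff_mul, ← Finset.add_sum_erase _ _ h0g] at hsum
    simp only [hz, one_mul] at hsum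
    have habs : |(z⁻¹).coeff g| ≤ (if g = 0 then 1 else 0) +
        ∑ p ∈ (Finset.antidiagonal z.isPWO_support (z⁻¹).isPWO_support g).erase (0, g),
          |z.coeff p.1 * (z⁻¹).coeff p.2| := by
      rw [eq_sub_of_add_eq hsum]
      refine (abs_sub _ _).trans (add_le_add ?_ (Finset.abs_sum_le_sum_abs _ _))
      split_ifs <;> simp
    refine (mul_le_mul_of_nonneg_right habs (Real.rpow_nonneg ht.le _)).trans ?_
    rw [add_mul]
    refine add_le_add ?_ ?_
    · split_ifs with h0 <;> simp [h0]
    · rw [Finset.sum_mul]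
      refine le_trans (le_of_eq ?_) (Finset.sum_le_sum_of_subset_of_nonneg
        (f := h) (s := (Finset.antidiagonal z.isPWO_support
          (z⁻¹).isPWO_support g).erase (0, g)) ?_ fun p _ _ => hh0 p)
      · refine Finset.sum_congr rfl fun p hp => ?_
        have := (Finset.mem_antidiagonal.1 (Finset.mem_of_mem_erase hp)).2.2
        rw [← this, neg_add, Real.rpow_add ht, abs_mul, hh]
        ring
      · intro p hp
        obtain ⟨hpne, hp⟩ := Finset.mem_erase.1 hp
        obtain ⟨hp1, hp2, hp3⟩ := Finset.mem_antidiagonal.1 hp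
        have hp10 : p.1 ≠ 0 := fun h => hpne (Prod.ext h (by simpa [h] using hp3))
        have h1 := HahnSeries.order_le_of_coeff_ne_zero hp1
        have h2 := HahnSeries.order_le_of_coeff_ne_zero hp2
        rw [hord] at h1
        rw [hord'] at h2
        have h4 := hgF.2
        simp only [Finset.mem_filter, Finset.mem_product, hG, hF, Finset.mem_erase,
          Set.Finite.mem_toFinset, Set.mem_inter_iff, Set.mem_Iic]
        exact ⟨⟨⟨hp10, hp1, by linarith⟩, hp2, by linarith⟩, hp3⟩
  set S := ∑ g ∈ F, |(z⁻¹).coeff g| * t ^ (-g) with hS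
  have hS0 : 0 ≤ S := Finset.sum_nonneg fun g _ => by positivity
  have hfib : ∑ g ∈ F, ∑ p ∈ (G ×ˢ F).filter (fun p => p.1 + p.2 = g), h p
      ≤ ∑ p ∈ G ×ˢ F, h p :=
    Finset.sum_fiberwise_le_sum_of_sum_fiber_nonneg fun g _ => Finset.sum_nonneg fun p _ => hh0 p
  have hprod : ∑ p ∈ G ×ˢ F, h p = (∑ g ∈ G, |z.coeff g| * t ^ (-g)) * S := by
    rw [hS, Finset.sum_mul_sum, Finset.sum_product]
  have hone : ∑ g ∈ F, (if g = 0 then (1 : ℝ) else 0) ≤ 1 := by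
    rw [Finset.sum_ite_eq']
    split_ifs <;> simp
  have hfinal := Finset.sum_le_sum hterm
  rw [Finset.sum_add_distrib] at hfinal
  nlinarith [mul_le_mul_of_nonneg_right hGle hS0]

theorem IsAbsConvPuiseux.inv_of_normalized {z : HahnSeries ℝ ℝ} (h : IsAbsConvPuiseux (toLex z))
    (hz : z.coeff 0 = 1) (hord : z.order = 0) : IsAbsConvPuiseux (toLex z⁻¹) := by
  have hfin := HahnSeries.finite_support_inv_inter_Iic hz hord h.1
  refine ⟨hfin, ?_⟩
  obtain ⟨T, hT, hT0⟩ := (h.2.and (eventually_gt_atTop 0)).exists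
  -- The absolute series of `z` tends to its constant term 1, hence is eventually at most `3 / 2`.
  have hlim := tendsto_tsum_mul_rpow (f := fun g => |z.coeff g|) (g₀ := 0)
    (fun g hg => by rw [HahnSeries.coeff_eq_zero_of_lt_order (hord.symm ▸ hg), abs_zero])
    hT0 (by simpa using hT)
  simp only [Real.rpow_zero, mul_one, hz, abs_one] at hlim
  filter_upwards [hlim.eventually (ge_mem_nhds (show (1 : ℝ) < 3 / 2 by norm_num)), h.2,
    eventually_gt_atTop 0] with t hle hs ht
  refine summable_of_sum_le (c := 2) (fun g => by positivity) fun u => ?_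
  obtain ⟨a, ha⟩ := u.exists_le
  refine le_trans ?_ (HahnSeries.sum_abs_coeff_inv_le hz hord h.1 ht hs hle a)
  rw [← Finset.sum_filter_ne_zero]
  refine Finset.sum_le_sum_of_subset_of_nonneg (fun g hg => ?_) fun g _ _ => by positivity
  obtain ⟨hg, hne⟩ := Finset.mem_filter.1 hg
  simp only [Set.Finite.mem_toFinset, Set.mem_inter_iff, Set.mem_Iic]
  exact ⟨fun h0 => hne (by simp [h0]), ha g hg⟩

/-- Multiplying by a monomial reduces to order 0 and leading coefficient 1. -/
theorem Puiseux.exists_mul_eq_one {z : Puiseux} (hz : z ≠ 0) : ∃ w, z * w = 1 := by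
  set a := (ofLex z.1).leadingCoeff with ha
  have hz' : ofLex z.1 ≠ 0 := fun h => hz (Subtype.ext h)
  have ha0 : a ≠ 0 := HahnSeries.leadingCoeff_ne_zero.2 hz'
  set u := Puiseux.monomial (-exponent z) a⁻¹ with hu
  have hu0 : HahnSeries.single (exponent z) a⁻¹ ≠ 0 := HahnSeries.single_ne_zero (inv_ne_zero ha0)
  have huz : ofLex (z * u).1 = ofLex z.1 * HahnSeries.single (exponent z) a⁻¹ := by
    show ofLex z.1 * HahnSeries.single (- -exponent z) a⁻¹ = _
    rw [neg_neg]
  have hord : (ofLex (z * u).1).order = 0 := by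
    rw [huz, HahnSeries.order_mul hz' hu0, HahnSeries.order_single (inv_ne_zero ha0), exponent]
    ring
  have hco : (ofLex (z * u).1).coeff 0 = 1 := by
    have h1 : (ofLex (z * u).1).leadingCoeff = 1 := by
      rw [huz, HahnSeries.leadingCoeff_mul, HahnSeries.leadingCoeff_of_single, ← ha,
        mul_inv_cancel₀ ha0]
    rwa [HahnSeries.leadingCoeff_eq, hord] at h1
  have hne : ofLex (z * u).1 ≠ 0 := by
    intro h0
    rw [h0] at hco
    simp at hco
  refine ⟨u * ⟨toLex (ofLex (z * u).1)⁻¹,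
    IsAbsConvPuiseux.inv_of_normalized (z * u).2 hco hord⟩, ?_⟩
  rw [← mul_assoc]
  exact Subtype.ext (congrArg toLex (mul_inv_cancel₀ hne))

/-- Extends the existing ring structure, so that it stays compatible with the order and the results
on ordered fields below apply. -/
noncomputable instance Puiseux.instField : Field Puiseux where
  __ := (inferInstance : CommRing Puiseux)
  inv z := open Classical in if h : z ≠ 0 then (Puiseux.exists_mul_eq_one h).choose else 0
  exists_pair_ne := ⟨0, 1, zero_ne_one⟩
  mul_inv_cancel z hz := by
    rw [dif_pos hz]
    exact (Puiseux.exists_mul_eq_one hz).choose_spec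
  inv_zero := by simp
  nnqsmul := _
  nnqsmul_def := fun _ _ => rfl
  qsmul := _
  qsmul_def := fun _ _ => rfl

/-! ### Linear inequalities over an ordered field -/

section LinearInequalities

/-- Supplies the value of the eliminated variable in Fourier–Motzkin elimination; either family of
bounds may be empty. -/
theorem exists_between_finite {K ι κ : Type*} [LinearOrder K] [Zero K] [Finite ι] [Finite κ] (l : ι → K) (u : κ → K)
    (h : ∀ i k, l i ≤ u k) : ∃ x, (∀ i, l i ≤ x) ∧ ∀ k, x ≤ u k := by
  cases isEmpty_or_nonempty ι with
  | inl hι =>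
    cases isEmpty_or_nonempty κ with
    | inl hκ => exact ⟨0, fun i => hι.elim i, fun k => hκ.elim k⟩
    | inr hκ =>
      obtain ⟨k, hk⟩ := Finite.exists_min u
      exact ⟨u k, fun i => hι.elim i, hk⟩
  | inr hι =>
    obtain ⟨i, hi⟩ := Finite.exists_max l
    exact ⟨l i, hi, h i⟩

variable {K : Type*} [Field K] [LinearOrder K] [IsStrictOrderedRing K]

/-- Fourier–Motzkin elimination: the right-hand sides `b` for which `A x ≤ b` is solvable are cut
out by finitely many nonnegative vectors of multipliers that annihilate the rows of `A`. -/
theorem exists_multipliers_of_matrix {n : ℕ} {ι : Type} [Fintype ι] (A : Matrix ι (Fin n) K) :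
    ∃ (r : ℕ) (Y : Fin r → ι → K), (∀ v i, 0 ≤ Y v i) ∧ (∀ v, Y v ᵥ* A = 0) ∧
      ∀ b : ι → K, (∀ v, 0 ≤ Y v ⬝ᵥ b) → ∃ x, A *ᵥ x ≤ b := by
  classical
  induction n generalizing ι with
  | zero =>
    refine ⟨Fintype.card ι, fun v => Pi.single ((Fintype.equivFin ι).symm v) 1, fun v i => ?_,
      fun v => Subsingleton.elim _ _, fun b hb => ⟨0, fun i => ?_⟩⟩
    · by_cases h : i = (Fintype.equivFin ι).symm v
      · subst h; simp
      · simp [h]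
    · have := hb (Fintype.equivFin ι i)
      simpa using this
  | succ n ih =>
    let Zer := {i : ι // A i 0 = 0}
    let Pos := {i : ι // 0 < A i 0}
    let Neg := {i : ι // A i 0 < 0}
    -- The rows of `M` encode one elimination step: rows free of the first variable are kept, and
    -- each pair of rows with opposite signs is combined with nonnegative weights so that this
    -- variable cancels.
    let M : Matrix (Zer ⊕ Pos × Neg) ι K := fun k => k.elim (fun i => Pi.single i.1 1)
      fun pq => A pq.1.1 0 • Pi.single pq.2.1 1 - A pq.2.1 0 • Pi.single pq.1.1 1
    have hM0 : ∀ k i, 0 ≤ M k i := by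
      rintro (k | ⟨p, q⟩) i
      · show 0 ≤ (Pi.single k.1 1 : ι → K) i
        exact (Pi.single_nonneg.2 zero_le_one : (0 : ι → K) ≤ _) i
      · have h1 : 0 ≤ (Pi.single q.1 1 : ι → K) i :=
          (Pi.single_nonneg.2 zero_le_one : (0 : ι → K) ≤ _) i
        have h2 : 0 ≤ (Pi.single p.1 1 : ι → K) i :=
          (Pi.single_nonneg.2 zero_le_one : (0 : ι → K) ≤ _) i
        have := mul_nonneg p.2.le h1
        show 0 ≤ A p.1 0 * (Pi.single q.1 1 : ι → K) i - A q.1 0 * (Pi.single p.1 1 : ι → K) i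
        linarith [mul_nonneg (neg_nonneg.2 q.2.le) h2]
    have hMZ : ∀ (i : Zer) (f : ι → K), (M *ᵥ f) (Sum.inl i) = f i.1 := by
      intro i f
      show (Pi.single i.1 1 : ι → K) ⬝ᵥ f = _
      simp
    have hMP : ∀ (p : Pos) (q : Neg) (f : ι → K),
        (M *ᵥ f) (Sum.inr (p, q)) = A p.1 0 * f q.1 - A q.1 0 * f p.1 := by
      intro p q f
      show (A p.1 0 • (Pi.single q.1 1 : ι → K) - A q.1 0 • Pi.single p.1 1) ⬝ᵥ f = _
      rw [sub_dotProduct, smul_dotProduct, smul_dotProduct]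
      simp
    let A₁ : Matrix ι (Fin n) K := fun i j => A i j.succ
    obtain ⟨r, Y, hY0, hYA, hY⟩ := ih (M * A₁)
    refine ⟨r, fun v => Y v ᵥ* M, fun v i => ?_, fun v => ?_, fun b hb => ?_⟩
    · exact Finset.sum_nonneg fun k _ => mul_nonneg (hY0 v k) (hM0 k i)
    · have hcol : M *ᵥ (fun i => A i 0) = 0 := by
        ext k
        rcases k with k | ⟨p, q⟩
        · rw [hMZ]; exact k.2
        · rw [hMP, mul_comm]; simp
      ext j
      refine Fin.cases ?_ (fun j => ?_) j
      · show (Y v ᵥ* M) ⬝ᵥ (fun i => A i 0) = 0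
        rw [← dotProduct_mulVec, hcol, dotProduct_zero]
      · have := congrFun (hYA v) j
        rw [← vecMul_vecMul] at this
        exact this
    · obtain ⟨x, hx⟩ := hY (M *ᵥ b) fun v => by
        rw [dotProduct_mulVec]; exact hb v
      rw [← mulVec_mulVec] at hx
      set f := A₁ *ᵥ x with hf
      obtain ⟨y, hyl, hyu⟩ := exists_between_finite
        (fun q : Neg => (b q.1 - f q.1) / A q.1 0) (fun p : Pos => (b p.1 - f p.1) / A p.1 0)
        (fun q p => by
          have h1 := hx (Sum.inr (p, q))
          rw [hMP, hMP] at h1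
          rw [le_div_iff₀ p.2, div_mul_eq_mul_div, div_le_iff_of_neg q.2]
          linarith)
      refine ⟨Fin.cons y x, fun i => ?_⟩
      have hi : (A *ᵥ (Fin.cons y x : Fin (n + 1) → K)) i = A i 0 * y + f i := by
        simp [mulVec, dotProduct, Fin.sum_univ_succ, hf, A₁]
      rw [hi]
      rcases lt_trichotomy (A i 0) 0 with h | h | h
      · have := hyl ⟨i, h⟩
        simp only at this
        rw [div_le_iff_of_neg h] at this
        linarith
      · have := hx (Sum.inl ⟨i, h⟩)
        rw [hMZ, hMZ] at this
        simp only at this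
        rw [h]
        linarith
      · have := hyu ⟨i, h⟩
        simp only at this
        rw [le_div_iff₀ h] at this
        linarith

/-- The maximum of `a ⬝ᵥ x` subject to `A x ≤ b` is, for all `b`, the smallest value of finitely
many dual solutions that do not depend on `b`. -/
theorem exists_dual_solutions {n : ℕ} {ι : Type} [Fintype ι] (A : Matrix ι (Fin n) K)
    (a : Fin n → K) :
    ∃ (κ : Type) (_ : Finite κ) (Y : κ → ι → K), (∀ v i, 0 ≤ Y v i) ∧ (∀ v, Y v ᵥ* A = a) ∧
      ∀ b, (∃ x, A *ᵥ x ≤ b) → ∀ τ, (∀ v, τ ≤ Y v ⬝ᵥ b) → ∃ x, A *ᵥ x ≤ b ∧ τ ≤ a ⬝ᵥ x := by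
  -- The extra row encodes `τ ≤ a ⬝ᵥ x`. Multipliers with positive weight on it become dual
  -- solutions after division by that weight.
  let A₁ : Matrix (Unit ⊕ ι) (Fin n) K := Sum.elim (fun _ => -a) A
  obtain ⟨r, Y, hY0, hYA, hY⟩ := exists_multipliers_of_matrix A₁
  have hb : ∀ (v : Fin r) (τ : K) (b : ι → K), Y v ⬝ᵥ (Sum.elim (fun _ => -τ) b) =
      (fun i => Y v (Sum.inr i)) ⬝ᵥ b - Y v (Sum.inl ()) * τ := by
    intro v τ b
    simp only [dotProduct, Fintype.sum_sum_type, Finset.univ_unique, Finset.sum_singleton,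
      Sum.elim_inl, Sum.elim_inr]
    ring
  have hA : ∀ v, (fun i => Y v (Sum.inr i)) ᵥ* A = Y v (Sum.inl ()) • a := by
    intro v
    ext j
    have h1 : Y v (Sum.inl ()) * (-a j) + ∑ i, Y v (Sum.inr i) * A i j = 0 := by
      have h2 := congrFun (hYA v) j
      simp only [vecMul, dotProduct, Fintype.sum_sum_type, Finset.univ_unique,
        Finset.sum_singleton] at h2
      exact h2
    show ∑ i, Y v (Sum.inr i) * A i j = Y v (Sum.inl ()) * a j
    linarith
  refine ⟨{v : Fin r // 0 < Y v (Sum.inl ())}, inferInstance,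
    fun v => (Y v.1 (Sum.inl ()))⁻¹ • fun i => Y v.1 (Sum.inr i),
    fun v i => mul_nonneg (inv_nonneg.2 v.2.le) (hY0 v _), fun v => ?_, fun b ⟨x₀, hx₀⟩ τ hτ => ?_⟩
  · rw [smul_vecMul, hA, smul_smul, inv_mul_cancel₀ v.2.ne', one_smul]
  · obtain ⟨x, hx⟩ := hY (Sum.elim (fun _ => -τ) b) fun v => by
      rw [hb]
      -- A multiplier of weight zero on the extra row only tests feasibility of `b`, which `x₀`
      -- witnesses.
      rcases (hY0 v (Sum.inl ())).eq_or_lt with h0 | hv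
      · rw [← h0, zero_mul, sub_zero]
        have h1 : 0 ≤ (fun i => Y v (Sum.inr i)) ⬝ᵥ (b - A *ᵥ x₀) :=
          dotProduct_nonneg_of_nonneg (fun i => hY0 v _) fun i => sub_nonneg.2 (hx₀ i)
        rw [dotProduct_sub, dotProduct_mulVec, hA, ← h0] at h1
        simpa using h1
      · have := hτ ⟨v, hv⟩
        rw [smul_dotProduct, smul_eq_mul, ← div_eq_inv_mul, le_div_iff₀ hv] at this
        linarith
    refine ⟨x, fun i => hx (Sum.inr i), ?_⟩
    have h2 : (-a) ⬝ᵥ x ≤ -τ := hx (Sum.inl ())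
    rw [neg_dotProduct] at h2
    linarith

theorem exists_lt_forall_le {K : Type*} [Field K] [LinearOrder K] [IsStrictOrderedRing K]
    {κ : Type*} [Finite κ] (f : κ → K) (β : K) (h : ∀ v, β < f v) : ∃ τ, β < τ ∧ ∀ v, τ ≤ f v := by
  cases isEmpty_or_nonempty κ with
  | inl hκ => exact ⟨β + 1, lt_add_one β, fun v => hκ.elim v⟩
  | inr hκ =>
    obtain ⟨v, hv⟩ := Finite.exists_min f
    exact ⟨f v, h v, hv⟩

/-- The affine form of Farkas' lemma. -/
theorem exists_multipliers_of_implied {n : ℕ} {ι : Type} [Fintype ι] (A : Matrix ι (Fin n) K)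
    (b : ι → K) (a : Fin n → K) (β : K) (hne : ∃ x, A *ᵥ x ≤ b)
    (h : ∀ x, A *ᵥ x ≤ b → a ⬝ᵥ x ≤ β) :
    ∃ y : ι → K, (∀ i, 0 ≤ y i) ∧ y ᵥ* A = a ∧ y ⬝ᵥ b ≤ β := by
  obtain ⟨κ, _, Y, hY0, hYA, hY⟩ := exists_dual_solutions A a
  by_contra hcon
  push Not at hcon
  -- There are finitely many dual solutions, so if all their values exceed `β` then a single `τ > β`
  -- lies below all of them and is reached by a primal point.
  obtain ⟨τ, hτ, hτv⟩ := exists_lt_forall_le (fun v => Y v ⬝ᵥ b) β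
    fun v => hcon (Y v) (hY0 v) (hYA v)
  obtain ⟨x, hx, hτx⟩ := hY b hne τ hτv
  exact absurd (h x hx) (not_le.2 (hτ.trans_le hτx))

/-- The maximum of `a ⬝ᵥ x` over the points of a polyhedron with `c ⬝ᵥ x ≤ μ` is attained and
equal to the value of one of finitely many dual solutions, which do not depend on `μ`. -/
theorem exists_parametric_dual {n : ℕ} {ι : Type} [Fintype ι] (A : Matrix ι (Fin n) K)
    (b : ι → K) (c a : Fin n → K) (hnn : ∀ x, A *ᵥ x ≤ b → 0 ≤ x) (h0 : 0 ≤ b)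
    (hc : ∀ j, 0 < c j) :
    ∃ (κ : Type) (_ : Finite κ) (y : κ → ι → K) (z : κ → K), (∀ v i, 0 ≤ y v i) ∧
      (∀ v, 0 ≤ z v) ∧ (∀ v, y v ᵥ* A + z v • c = a) ∧
      ∀ μ, 0 < μ → ∃ x v, A *ᵥ x ≤ b ∧ c ⬝ᵥ x ≤ μ ∧ a ⬝ᵥ x = y v ⬝ᵥ b + z v * μ := by
  let A₁ : Matrix (Unit ⊕ ι) (Fin n) K := Sum.elim (fun _ => c) A
  obtain ⟨κ, hκ, Y, hY0, hYA, hY⟩ := exists_dual_solutions A₁ a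
  have hb : ∀ v (μ : K), Y v ⬝ᵥ (Sum.elim (fun _ => μ) b) =
      (fun i => Y v (Sum.inr i)) ⬝ᵥ b + Y v (Sum.inl ()) * μ := by
    intro v μ
    simp only [dotProduct, Fintype.sum_sum_type, Finset.univ_unique, Finset.sum_singleton,
      Sum.elim_inl, Sum.elim_inr]
    ring
  have hA : ∀ v, (fun i => Y v (Sum.inr i)) ᵥ* A + Y v (Sum.inl ()) • c = a := by
    intro v
    ext j
    have h1 : Y v (Sum.inl ()) * c j + ∑ i, Y v (Sum.inr i) * A i j = a j := by
      have h2 := congrFun (hYA v) j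
      simp only [vecMul, dotProduct, Fintype.sum_sum_type, Finset.univ_unique,
        Finset.sum_singleton] at h2
      exact h2
    show ∑ i, Y v (Sum.inr i) * A i j + Y v (Sum.inl ()) * c j = a j
    linarith
  refine ⟨κ, hκ, fun v i => Y v (Sum.inr i), fun v => Y v (Sum.inl ()), fun v i => hY0 v _,
    fun v => hY0 v _, hA, fun μ hμ => ?_⟩
  have hfeas : ∃ x, A₁ *ᵥ x ≤ Sum.elim (fun _ => μ) b := by
    refine ⟨0, ?_⟩
    rw [mulVec_zero]
    rintro (_ | i)
    · exact hμ.le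
    · exact h0 i
  -- Without dual solutions the objective would be unbounded, but `x ≥ 0`, `c > 0` and `c ⬝ᵥ x ≤ μ`
  -- force `x j ≤ μ / c j`.
  have hne : Nonempty κ := by
    by_contra hemp
    rw [not_nonempty_iff] at hemp
    obtain ⟨x, hx, hτ⟩ := hY _ hfeas (∑ j, |a j| * (μ / c j) + 1) fun v => hemp.elim v
    have hx0 : 0 ≤ x := hnn x fun i => hx (Sum.inr i)
    have hcx : c ⬝ᵥ x ≤ μ := hx (Sum.inl ())
    have : a ⬝ᵥ x ≤ ∑ j, |a j| * (μ / c j) := by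
      refine Finset.sum_le_sum fun j _ => ?_
      have h1 : c j * x j ≤ c ⬝ᵥ x :=
        Finset.single_le_sum (f := fun j => c j * x j)
          (fun i _ => mul_nonneg (hc i).le (hx0 i)) (Finset.mem_univ j)
      refine mul_le_mul (le_abs_self _) ?_ (hx0 j) (abs_nonneg _)
      rw [le_div_iff₀ (hc j)]
      linarith
    linarith
  obtain ⟨v, hv⟩ := Finite.exists_min fun v => Y v ⬝ᵥ (Sum.elim (fun _ => μ) b)
  obtain ⟨x, hx, hτ⟩ := hY _ hfeas _ hv
  have hxA : A *ᵥ x ≤ b := fun i => hx (Sum.inr i)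
  have hcx : c ⬝ᵥ x ≤ μ := hx (Sum.inl ())
  refine ⟨x, v, hxA, hcx, le_antisymm ?_ (hb v μ ▸ hτ)⟩
  rw [← hA v, add_dotProduct, smul_dotProduct, smul_eq_mul, ← dotProduct_mulVec]
  exact add_le_add (dotProduct_le_dotProduct_of_nonneg_left hxA fun i => hY0 v _)
    (mul_le_mul_of_nonneg_left hcx (hY0 v _))

end LinearInequalities

/-! ### From polyhedra over Puiseux series to real polyhedra -/

namespace Puiseux

theorem coeff_sum {ι : Type*} (s : Finset ι) (f : ι → Puiseux) (g : ℝ) :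
    (ofLex (∑ i ∈ s, f i).1).coeff g = ∑ i ∈ s, (ofLex (f i).1).coeff g := by
  classical
  induction s using Finset.induction_on with
  | empty => simp
  | insert a s ha ih =>
    rw [Finset.sum_insert ha, Finset.sum_insert ha, ← ih]
    rfl

theorem tendsto_coe_atBot_nhds_bot :
    Tendsto (fun s : ℝ => (s : WithBot ℝ)) atBot (𝓝 ⊥) := by
  refine tendsto_order.2 ⟨fun a ha => absurd ha not_lt_bot, fun a ha => ?_⟩
  induction a with
  | bot => exact absurd ha (lt_irrefl _)
  | coe a =>
    filter_upwards [eventually_lt_atBot a] with s hs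
    exact WithBot.coe_lt_coe.2 hs

/-- A coordinate `-∞` is a limit of reals, so an open set meets the finite points; openness then
leaves room to raise any single coordinate by a common `δ`. -/
theorem exists_real_mem_of_isOpen {n : ℕ} {U : Set (Fin n → WithBot ℝ)} (hU : IsOpen U)
    (hne : U.Nonempty) :
    ∃ (u : Fin n → ℝ) (δ : ℝ), 0 < δ ∧
      ∀ i, (fun j => ((u j + if j = i then δ else 0 : ℝ) : WithBot ℝ)) ∈ U := by
  obtain ⟨p, hp⟩ := hne
  have h1 : Tendsto (fun (s : ℝ) (j : Fin n) => (((p j).unbotD s : ℝ) : WithBot ℝ)) atBot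
      (𝓝 p) := by
    refine tendsto_pi_nhds.2 fun j => ?_
    cases h : p j with
    | bot => simpa using tendsto_coe_atBot_nhds_bot
    | coe r => simp
  obtain ⟨s, hs⟩ := (h1.eventually (hU.mem_nhds hp)).exists
  set u : Fin n → ℝ := fun j => (p j).unbotD s with hu
  have hcoe : Continuous fun r : ℝ => (r : WithBot ℝ) := WithBot.isEmbedding_coe.continuous
  have h2 : ∀ i, ∀ᶠ δ in 𝓝[>] (0 : ℝ),
      (fun j => ((u j + if j = i then δ else 0 : ℝ) : WithBot ℝ)) ∈ U := by
    intro i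
    have hcont : Continuous fun δ : ℝ =>
        (fun j => ((u j + if j = i then δ else 0 : ℝ) : WithBot ℝ)) := by
      refine continuous_pi fun j => hcoe.comp ?_
      by_cases hj : j = i
      · simp only [hj, if_true]; fun_prop
      · simp only [hj, if_false]; fun_prop
    refine nhdsWithin_le_nhds (hcont.continuousAt.eventually (hU.mem_nhds ?_))
    simp only [ite_self, add_zero]
    exact hs
  obtain ⟨δ, hδ, hδ0⟩ := ((eventually_all.2 h2).and self_mem_nhdsWithin).exists
  exact ⟨u, δ, hδ0, hδ⟩

/-- Choose `i` maximizing the exponent of the term `a j * x j` at valuations `u`. Raising the `i`-th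
valuation by `δ` makes that term strictly dominant, so its leading coefficient cannot cancel. -/
theorem exists_dotProduct_ne_zero {n : ℕ} {P : Set (Fin n → Puiseux)}
    (hint : (interior ((fun (x : Fin n → Puiseux) i => (x i).val) '' P)).Nonempty)
    {a : Fin n → Puiseux} (ha : a ≠ 0) : ∃ x ∈ P, a ⬝ᵥ x ≠ 0 := by
  classical
  obtain ⟨u, δ, hδ, hmem⟩ := exists_real_mem_of_isOpen isOpen_interior hint
  obtain ⟨j₀, hj₀⟩ := Function.ne_iff.1 ha
  obtain ⟨i, hi, hmax⟩ := Finset.exists_max_image (Finset.univ.filter fun j => a j ≠ 0)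
    (fun j => exponent (a j) + u j) ⟨j₀, by simpa using hj₀⟩
  have hai : a i ≠ 0 := (Finset.mem_filter.1 hi).2
  obtain ⟨x, hxP, hx⟩ := interior_subset (hmem i)
  refine ⟨x, hxP, fun h0 => ?_⟩
  have hval : ∀ j, x j ≠ 0 ∧ exponent (x j) = u j + if j = i then δ else 0 :=
    fun j => val_eq_coe_iff.1 (congrFun hx j)
  set g := -(exponent (a i) + u i + δ) with hg
  have h1 : (ofLex (a ⬝ᵥ x).1).coeff g = (ofLex (a i * x i).1).coeff g := by
    rw [dotProduct, coeff_sum]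
    refine Finset.sum_eq_single i (fun j _ hj => ?_) (by simp)
    by_cases haj : a j = 0
    · simp [haj]
    · refine HahnSeries.coeff_eq_zero_of_lt_order ?_
      have h2 := hmax j (by simpa using haj)
      have h3 : exponent (a j * x j) = exponent (a j) + u j := by
        rw [exponent_mul haj (hval j).1, (hval j).2, if_neg hj, add_zero]
      rw [exponent] at h3
      rw [hg]
      linarith
  have h4 : (ofLex (a i * x i).1).order = g := by
    have h5 : exponent (a i * x i) = exponent (a i) + u i + δ := by
      rw [exponent_mul hai (hval i).1, (hval i).2, if_pos rfl, add_assoc]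
    rw [exponent] at h5
    linarith
  have h6 : (ofLex (a i * x i).1).leadingCoeff ≠ 0 :=
    HahnSeries.leadingCoeff_ne_zero.2 fun h => mul_ne_zero hai (hval i).1 (Subtype.ext h)
  rw [HahnSeries.leadingCoeff_eq, h4, ← h1, h0] at h6
  simp at h6

theorem exponent_add_self {x : Puiseux} (hx : x ≠ 0) : exponent (x + x) = exponent x := by
  have h : x + x = monomial 0 2 * x := by
    have : monomial 0 2 = monomial 0 1 + monomial 0 1 := by
      refine Subtype.ext (congrArg toLex ?_)
      show HahnSeries.single (-0 : ℝ) (2 : ℝ)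
        = HahnSeries.single (-0 : ℝ) (1 : ℝ) + HahnSeries.single (-0 : ℝ) (1 : ℝ)
      ext g
      rw [HahnSeries.coeff_add, HahnSeries.coeff_single, HahnSeries.coeff_single]
      split_ifs <;> norm_num
    rw [this, monomial_zero_one]
    ring
  rw [h, exponent_mul (monomial_pos two_pos).ne' hx, exponent_monomial two_ne_zero, zero_add]

/-- If `x ≤ y` then `y ≤ x + y ≤ y + y`, and doubling does not change the exponent. -/
theorem exponent_add_eq_or {x y : Puiseux} (hx : 0 ≤ x) (hy : 0 ≤ y) (h : 0 < x + y) :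
    (x ≠ 0 ∧ exponent (x + y) = exponent x) ∨ (y ≠ 0 ∧ exponent (x + y) = exponent y) := by
  wlog hxy : x ≤ y generalizing x y
  · rw [add_comm] at h ⊢
    exact (this hy hx h (not_le.1 hxy).le).symm
  have hy0 : 0 < y := by
    rcases hy.eq_or_lt with h0 | h0
    · rw [← h0] at h hxy; simp only [add_zero] at h; exact absurd h (not_lt.2 hxy)
    · exact h0
  refine Or.inr ⟨hy0.ne', le_antisymm ?_ (exponent_mono hy0 (le_add_of_nonneg_left hx))⟩
  rw [← exponent_add_self hy0.ne']
  exact exponent_mono h (by gcongr)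

theorem eval_single (t : ℝ) {n : ℕ} (j : Fin n) :
    (fun l => Puiseux.eval t ((Pi.single j 1 : Fin n → Puiseux) l)) = Pi.single j 1 := by
  ext l
  by_cases h : l = j
  · subst h; simp [Puiseux.eval_one]
  · simp [h, Puiseux.eval_zero]

theorem eval_neg_vec (t : ℝ) {n : ℕ} (a : Fin n → Puiseux) :
    (fun l => Puiseux.eval t ((-a) l)) = -fun l => Puiseux.eval t (a l) :=
  funext fun l => Puiseux.eval_neg t (a l)

theorem eventually_eval_mulVec_le {n : ℕ} {ι : Type*} [Finite ι] {A : Matrix ι (Fin n) Puiseux}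
    {b : ι → Puiseux} {x : Fin n → Puiseux} (hx : A *ᵥ x ≤ b) :
    ∀ᶠ t in atTop, A.map (eval t) *ᵥ (fun j => eval t (x j)) ≤ fun i => eval t (b i) := by
  filter_upwards [eventually_all.2 fun i => eventually_eval_le (hx i),
    eventually_all.2 fun i => eventually_eval_dotProduct (A i) x] with t h1 h2 i
  have := h1 i
  rw [mulVec, h2 i] at this
  exact this

/-- Dual solutions over Puiseux series bound the real programs for large `t`. -/
theorem eventually_dotProduct_le_of_dual {n : ℕ} {ι : Type*} [Fintype ι]
    {A : Matrix ι (Fin n) Puiseux} {b : ι → Puiseux} {c a : Fin n → Puiseux} {y : ι → Puiseux}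
    {z : Puiseux} (hy : ∀ i, 0 ≤ y i) (ha : y ᵥ* A + z • c = a) :
    ∀ᶠ t in atTop, ∀ x : Fin n → ℝ, A.map (eval t) *ᵥ x ≤ (fun i => eval t (b i)) →
      (fun j => eval t (a j)) ⬝ᵥ x ≤
        eval t (y ⬝ᵥ b) + eval t z * ((fun j => eval t (c j)) ⬝ᵥ x) := by
  filter_upwards [eventually_all.2 fun i => eventually_eval_nonneg (hy i),
    eventually_eval_dotProduct y b,
    eventually_all.2 fun j => eventually_eval_dotProduct y fun i => A i j,
    eventually_all.2 fun j => eventually_eval_mul z (c j),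
    eventually_all.2 fun j => eventually_eval_add (y ⬝ᵥ fun i => A i j) (z * c j)]
    with t h1 h2 h3 h4 h5 x hx
  have haj : (fun j => eval t (a j)) =
      (fun i => eval t (y i)) ᵥ* A.map (eval t) + eval t z • fun j => eval t (c j) := by
    ext j
    have := congrFun ha j
    rw [← this]
    show eval t ((y ⬝ᵥ fun i => A i j) + z * c j) = _
    rw [h5, h4, h3]
    rfl
  rw [haj, h2, add_dotProduct, smul_dotProduct, smul_eq_mul, ← dotProduct_mulVec]
  gcongr
  exact dotProduct_le_dotProduct_of_nonneg_left hx h1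

/-- Inequalities implied by a feasible system over Puiseux series are implied by its real
specializations for large `t`. -/
theorem eventually_implied {n : ℕ} {ι : Type} [Fintype ι]
    {A : Matrix ι (Fin n) Puiseux} {b : ι → Puiseux} {a : Fin n → Puiseux} {β : Puiseux}
    (hne : ∃ x, A *ᵥ x ≤ b) (h : ∀ x, A *ᵥ x ≤ b → a ⬝ᵥ x ≤ β) :
    ∀ᶠ t in atTop, ∀ x : Fin n → ℝ, A.map (eval t) *ᵥ x ≤ (fun i => eval t (b i)) →
      (fun j => eval t (a j)) ⬝ᵥ x ≤ eval t β := by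
  obtain ⟨y, hy0, hya, hyb⟩ := exists_multipliers_of_implied A b a β hne h
  filter_upwards [eventually_dotProduct_le_of_dual (b := b) (c := 0) (z := 0) hy0
    (by rw [hya, smul_zero, add_zero]), eventually_eval_le hyb] with t h1 h2 x hx
  have := h1 x hx
  rw [eval_zero, zero_mul, add_zero] at this
  exact this.trans h2

end Puiseux

/-- The points of the sublevel set `{x : A x ≤ b, c x ≤ μ}` of a real linear program. -/
def lpSublevel {n : ℕ} {ι : Type*} (A : Matrix ι (Fin n) ℝ) (b : ι → ℝ)
    (c : Fin n → ℝ) (μ : ℝ) : Set (Fin n → ℝ) :=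
  {x | A *ᵥ x ≤ b ∧ c ⬝ᵥ x ≤ μ}

/-! ### Parametric linear programming over Puiseux series -/

namespace Puiseux

/-- The maximum of a nonnegative affine functional over the sublevel sets `{x ∈ P : c x ≤ μ}` of a
linear program over Puiseux series, and the valuation of this maximum as a function of the
valuation of `μ`. -/
theorem exists_tropical_value {n : ℕ} {ι : Type} [Fintype ι] (A : Matrix ι (Fin n) Puiseux)
    (b : ι → Puiseux) (c a : Fin n → Puiseux) (β : Puiseux) (hnn : ∀ x, A *ᵥ x ≤ b → 0 ≤ x)
    (h0 : 0 ≤ b) (hc : ∀ j, 0 < c j) (hℓ : ∀ x, A *ᵥ x ≤ b → 0 ≤ a ⬝ᵥ x + β)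
    (hpos : ∃ x, A *ᵥ x ≤ b ∧ 0 < a ⬝ᵥ x + β) :
    ∃ F : ℝ → ℝ, Continuous F ∧
      (∃ L : Set (ℝ × ℝ), L.Finite ∧ ∀ lam, ∃ l ∈ L, F lam = lam * l.1 + l.2) ∧
      ∀ μ : Puiseux, 0 < μ → ∃ M : Puiseux, 0 < M ∧ exponent M = F (exponent μ) ∧
        ∀ᶠ t in atTop, IsGreatest ((fun x => (fun j => eval t (a j)) ⬝ᵥ x + eval t β) ''
          lpSublevel (A.map (eval t)) (fun i => eval t (b i)) (fun j => eval t (c j)) (eval t μ))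
          (eval t M) := by
  obtain ⟨κ, _, y, z, hy, hz, hyz, hatt⟩ := exists_parametric_dual A b c a hnn h0 hc
  have hβ : 0 ≤ β := by
    have := hℓ 0 (by rwa [mulVec_zero])
    rwa [dotProduct_zero, zero_add] at this
  have hyb : ∀ v, 0 ≤ y v ⬝ᵥ b := fun v => dotProduct_nonneg_of_nonneg (hy v) h0
  have : Nonempty κ := ⟨(hatt 1 one_pos).choose_spec.choose⟩
  choose! x v hxA hxc hxv using hatt
  have hweak : ∀ v x μ, A *ᵥ x ≤ b → c ⬝ᵥ x ≤ μ → a ⬝ᵥ x ≤ y v ⬝ᵥ b + z v * μ := by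
    intro v x μ hx hcx
    rw [← hyz v, add_dotProduct, smul_dotProduct, smul_eq_mul, ← dotProduct_mulVec]
    exact add_le_add (dotProduct_le_dotProduct_of_nonneg_left hx (hy v))
      (mul_le_mul_of_nonneg_left hcx (hz v))
  set M : Puiseux → Puiseux := fun μ => a ⬝ᵥ x μ + β with hM
  have hmax : ∀ μ, 0 < μ → ∀ x', A *ᵥ x' ≤ b → c ⬝ᵥ x' ≤ μ → a ⬝ᵥ x' + β ≤ M μ := by
    intro μ hμ x' hx' hcx'
    have := hweak (v μ) x' μ hx' hcx'
    rw [← hxv μ hμ] at this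
    exact add_le_add_left this β
  -- Shrinking towards the feasible point 0 keeps feasibility, and since `β ≥ 0` the affine
  -- functional loses at most the factor `s`.
  have hscale : ∀ (s : Puiseux) x', 0 ≤ s → s ≤ 1 → A *ᵥ x' ≤ b →
      A *ᵥ (s • x') ≤ b ∧ s * (a ⬝ᵥ x' + β) ≤ a ⬝ᵥ (s • x') + β := by
    intro s x' hs hs1 hx'
    refine ⟨fun i => ?_, ?_⟩
    · rw [mulVec_smul]
      have h1 : s * (A *ᵥ x') i ≤ s * b i := mul_le_mul_of_nonneg_left (hx' i) hs
      have h2 : s * b i ≤ 1 * b i := mul_le_mul_of_nonneg_right hs1 (h0 i)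
      rw [one_mul] at h2
      exact h1.trans h2
    · rw [dotProduct_smul, smul_eq_mul, mul_add]
      have h2 : s * β ≤ 1 * β := mul_le_mul_of_nonneg_right hs1 hβ
      rw [one_mul] at h2
      exact add_le_add_right h2 _
  have hMpos : ∀ μ, 0 < μ → 0 < M μ := by
    intro μ hμ
    obtain ⟨x', hx', hx'0⟩ := hpos
    -- A point where the functional is positive is shrunk until its cost is at most `μ`.
    have hcx' : 0 ≤ c ⬝ᵥ x' := dotProduct_nonneg_of_nonneg (fun j => (hc j).le) (hnn x' hx')
    set s := μ / (μ + c ⬝ᵥ x') with hs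
    have hden : 0 < μ + c ⬝ᵥ x' := add_pos_of_pos_of_nonneg hμ hcx'
    have hs0 : 0 < s := div_pos hμ hden
    have hs1 : s ≤ 1 := (div_le_one hden).2 (le_add_of_nonneg_right hcx')
    obtain ⟨h1, h2⟩ := hscale s x' hs0.le hs1 hx'
    refine lt_of_lt_of_le (mul_pos hs0 hx'0) (h2.trans (hmax μ hμ _ h1 ?_))
    rw [dotProduct_smul, smul_eq_mul, hs, div_mul_eq_mul_div, div_le_iff₀ hden]
    exact mul_le_mul_of_nonneg_left (le_add_of_nonneg_left hμ.le) hμ.le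
  have hmono : ∀ μ μ', 0 < μ → μ ≤ μ' → M μ ≤ M μ' := fun μ μ' hμ hle =>
    hmax μ' (hμ.trans_le hle) _ (hxA μ hμ) ((hxc μ hμ).trans hle)
  -- `M μ / μ` is nonincreasing: scale the maximizer for `μ'` by `μ / μ'`.
  have hlip : ∀ μ μ', 0 < μ → μ ≤ μ' → μ * M μ' ≤ μ' * M μ := by
    intro μ μ' hμ hle
    have hμ' := hμ.trans_le hle
    obtain ⟨h1, h2⟩ := hscale (μ / μ') (x μ') (div_pos hμ hμ').le ((div_le_one hμ').2 hle)
      (hxA μ' hμ')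
    have h3 := h2.trans (hmax μ hμ _ h1 (by
      rw [dotProduct_smul, smul_eq_mul, div_mul_eq_mul_div, div_le_iff₀ hμ']
      exact mul_le_mul_of_nonneg_left (hxc μ' hμ') hμ.le))
    rwa [div_mul_eq_mul_div, div_le_iff₀ hμ', mul_comm (M μ)] at h3
  have hexp : ∀ μ μ', 0 < μ → μ ≤ μ' → exponent (M μ) ≤ exponent (M μ') ∧
      exponent (M μ') ≤ exponent (M μ) + (exponent μ' - exponent μ) := by
    intro μ μ' hμ hle
    have hμ' := hμ.trans_le hle
    refine ⟨exponent_mono (hMpos μ hμ) (hmono μ μ' hμ hle), ?_⟩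
    have := exponent_mono (mul_pos hμ (hMpos μ' hμ')) (hlip μ μ' hμ hle)
    rw [exponent_mul hμ.ne' (hMpos μ' hμ').ne', exponent_mul hμ'.ne' (hMpos μ hμ).ne'] at this
    linarith
  -- The two-sided estimate shows that the exponent of the maximum depends on `μ` only through its
  -- exponent, so the monomial `t ^ lam` can represent all of them.
  have hcongr : ∀ μ μ', 0 < μ → 0 < μ' → exponent μ = exponent μ' →
      exponent (M μ) = exponent (M μ') := by
    intro μ μ' hμ hμ' he
    rcases le_total μ μ' with h | h
    · obtain ⟨h1, h2⟩ := hexp μ μ' hμ h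
      linarith
    · obtain ⟨h1, h2⟩ := hexp μ' μ hμ' h
      linarith
  have hmp : ∀ lam : ℝ, 0 < monomial lam 1 := fun lam => monomial_pos one_pos
  have hme : ∀ lam : ℝ, exponent (monomial lam 1) = lam := fun lam =>
    exponent_monomial one_ne_zero
  have hFle : ∀ lam lam' : ℝ, lam ≤ lam' →
      exponent (M (monomial lam 1)) ≤ exponent (M (monomial lam' 1)) ∧
      exponent (M (monomial lam' 1)) ≤ exponent (M (monomial lam 1)) + (lam' - lam) := by
    intro lam lam' hle
    rcases hle.eq_or_lt with rfl | hlt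
    · simp
    · have := hexp _ _ (hmp lam) (lt_of_exponent_lt (hmp lam') (by rwa [hme, hme])).le
      rwa [hme, hme] at this
  refine ⟨fun lam => exponent (M (monomial lam 1)), ?_, ?_, fun μ hμ =>
    ⟨M μ, hMpos μ hμ, hcongr _ _ hμ (hmp _) (hme _).symm, ?_⟩⟩
  · refine (LipschitzWith.of_le_add fun lam lam' => ?_).continuous
    rw [Real.dist_eq]
    rcases le_total lam lam' with h | h
    · exact (hFle lam lam' h).1.trans (le_add_of_nonneg_right (abs_nonneg _))
    · exact (hFle lam' lam h).2.trans (by gcongr; exact le_abs_self _)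
  -- The dual value is a sum of two nonnegative terms: if the constant one dominates the slope is 0,
  -- if the one with `μ` dominates it is 1.
  · refine ⟨Set.range (fun v => ((0 : ℝ), exponent (y v ⬝ᵥ b + β))) ∪
      Set.range (fun v => ((1 : ℝ), exponent (z v))),
      (Set.finite_range _).union (Set.finite_range _), fun lam => ?_⟩
    have hMv : M (monomial lam 1) = (y (v (monomial lam 1)) ⬝ᵥ b + β) +
        z (v (monomial lam 1)) * monomial lam 1 := by
      simp only [hM]
      rw [hxv _ (hmp lam)]
      ring
    have hp := hMpos _ (hmp lam)
    rw [hMv] at hp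
    rcases exponent_add_eq_or (add_nonneg (hyb _) hβ) (mul_nonneg (hz _) (hmp lam).le) hp
      with ⟨-, h⟩ | ⟨hne, h⟩
    · exact ⟨_, Or.inl ⟨v (monomial lam 1), rfl⟩, by simp only [hMv, h]; ring⟩
    · refine ⟨_, Or.inr ⟨v (monomial lam 1), rfl⟩, ?_⟩
      simp only [hMv, h]
      rw [exponent_mul (left_ne_zero_of_mul hne) (hmp lam).ne', hme]
      ring
  -- At large `t` the evaluated maximizer is feasible, and the evaluated dual solution certifies
  -- that it is optimal.
  · have hcx : c ⬝ᵥ x μ ≤ μ := hxc μ hμ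
    filter_upwards [eventually_eval_mulVec_le (hxA μ hμ), eventually_eval_le hcx,
      eventually_eval_dotProduct c (x μ), eventually_eval_dotProduct a (x μ),
      eventually_eval_add (a ⬝ᵥ x μ) β,
      eventually_dotProduct_le_of_dual (b := b) (hy (v μ)) (hyz (v μ)),
      eventually_eval_add (y (v μ) ⬝ᵥ b) (z (v μ) * μ), eventually_eval_mul (z (v μ)) μ,
      eventually_eval_nonneg (hz (v μ))] with t h1 h2 h3 h4 h5 h6 h7 h8 h9
    refine ⟨⟨fun j => eval t (x μ j), ⟨h1, by rwa [← h3]⟩, ?_⟩, ?_⟩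
    · simp only [hM]
      rw [h5, h4]
    · rintro _ ⟨x', ⟨hx', hcx'⟩, rfl⟩
      simp only [hM]
      rw [h5, hxv μ hμ, h7, h8]
      have := h6 x' hx'
      have := mul_le_mul_of_nonneg_left hcx' h9
      linarith

end Puiseux

/-! ### Piecewise linear functions -/

/-- A continuous function that agrees everywhere with one of finitely many affine functions is
affine away from finitely many points. -/
theorem exists_breakpoints_of_selection {f : ℝ → ℝ} (hf : Continuous f) {L : Set (ℝ × ℝ)}
    (hL : L.Finite) (hsel : ∀ r, ∃ l ∈ L, f r = r * l.1 + l.2) :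
    ∃ B : Finset ℝ, ∀ I : Set ℝ, I.OrdConnected → Disjoint I (B : Set ℝ) →
      ∃ u v : ℝ, ∀ r ∈ I, f r = r * u + v := by
  classical
  -- Breakpoints are the crossings of pairs of lines. Pairs of equal slope give the junk value 0, a
  -- harmless extra breakpoint.
  refine ⟨((hL.prod hL).image fun p => (p.2.2 - p.1.2) / (p.1.1 - p.2.1)).toFinset,
    fun I hI hdisj => ?_⟩
  rcases I.eq_empty_or_nonempty with rfl | ⟨r₀, hr₀⟩
  · exact ⟨0, 0, by simp⟩
  obtain ⟨l₀, hl₀, hf₀⟩ := hsel r₀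
  refine ⟨l₀.1, l₀.2, ?_⟩
  have hcross : ∀ l ∈ L, ∀ l' ∈ L, ∀ r ∈ I, r * l.1 + l.2 = r * l'.1 + l'.2 → l = l' := by
    intro l hl l' hl' r hr he
    by_contra hne
    have h1 : l.1 - l'.1 ≠ 0 := by
      intro h
      have h' : l.1 = l'.1 := sub_eq_zero.1 h
      rw [h'] at he
      exact hne (Prod.ext h' (by linarith))
    refine Set.disjoint_left.1 hdisj hr ?_
    simp only [Set.Finite.coe_toFinset]
    refine ⟨(l, l'), ⟨hl, hl'⟩, ?_⟩
    simp only
    rw [div_eq_iff h1]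
    linarith
  have hclosed : ∀ l : ℝ × ℝ, IsClosed {r | f r = r * l.1 + l.2} := fun l =>
    isClosed_eq hf (by fun_prop)
  have hpre : IsPreconnected I := hI.isPreconnected
  by_contra hcon
  push Not at hcon
  obtain ⟨r₁, hr₁, hne₁⟩ := hcon
  -- An interval without crossings is covered by two closed sets, agreement with `l₀` and agreement
  -- with another line; connectedness would make them meet, at a crossing.
  have hC : IsClosed (⋃ l ∈ L \ {l₀}, {r | f r = r * l.1 + l.2}) :=
    (hL.subset Set.sdiff_subset).isClosed_biUnion fun l _ => hclosed l
  obtain ⟨r, hrI, hr0, hr1⟩ := isPreconnected_closed_iff.1 hpre _ _ (hclosed l₀) hC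
    (fun r hr => by
      obtain ⟨l, hl, hfl⟩ := hsel r
      by_cases h : l = l₀
      · exact Or.inl (h ▸ hfl)
      · exact Or.inr (Set.mem_biUnion (⟨hl, h⟩ : l ∈ L \ {l₀}) hfl))
    ⟨r₀, hr₀, hf₀⟩
    ⟨r₁, hr₁, by
      obtain ⟨l, hl, hfl⟩ := hsel r₁
      refine Set.mem_biUnion (⟨hl, fun h => ?_⟩ : l ∈ L \ {l₀}) hfl
      rw [Set.mem_singleton_iff] at h
      exact hne₁ (h ▸ hfl)⟩
  obtain ⟨l, hl, hfl⟩ := Set.mem_iUnion₂.1 hr1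
  exact hl.2 (hcross l hl.1 l₀ hl₀ r hrI (hfl.symm.trans hr0))

theorem isPiecewiseLinear_of_selection {n : ℕ} {f : ℝ → Fin n → ℝ}
    (hf : ∀ j, Continuous fun r => f r j)
    (hsel : ∀ j, ∃ L : Set (ℝ × ℝ), L.Finite ∧ ∀ r, ∃ l ∈ L, f r j = r * l.1 + l.2) :
    IsPiecewiseLinear f := by
  classical
  have h : ∀ j, ∃ B : Finset ℝ, ∀ I : Set ℝ, I.OrdConnected → Disjoint I (B : Set ℝ) →
      ∃ u v : ℝ, ∀ r ∈ I, f r j = r * u + v := fun j => by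
    obtain ⟨L, hL, hs⟩ := hsel j
    exact exists_breakpoints_of_selection (hf j) hL hs
  choose B hB using h
  refine ⟨continuous_pi hf, Finset.univ.biUnion B, fun I hI hdisj => ?_⟩
  have h2 : ∀ j, ∃ u v : ℝ, ∀ r ∈ I, f r j = r * u + v := fun j =>
    hB j I hI (hdisj.mono_right (by
      intro r hr
      simp only [Finset.coe_biUnion, Set.mem_iUnion]
      exact ⟨j, by simp, hr⟩))
  choose u v huv using h2
  exact ⟨u, v, fun r hr => funext fun j => huv j r hr⟩

/-! ### The logarithmic central path of a real linear program -/

section LogCentral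

variable {k n : ℕ} {A : Matrix (Fin k) (Fin n) ℝ} {b : Fin k → ℝ} {c : Fin n → ℝ} {μ : ℝ}

/-- The duality gap between the dual part of `z` and an arbitrary `x`. At `z` itself it is `(n + k)
* μ` by complementarity, and comparing the two values yields the estimates below. -/
theorem IsLogCentralPoint.gap {z : PrimalDual k n} (hz : IsLogCentralPoint A b c μ z)
    (x : Fin n → ℝ) : z.s ⬝ᵥ x + z.y ⬝ᵥ (b - A *ᵥ x) = c ⬝ᵥ x + z.y ⬝ᵥ b := by
  rw [← hz.dual, sub_dotProduct, dotProduct_sub, dotProduct_mulVec, mulVec_transpose]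
  ring

theorem IsLogCentralPoint.w_eq {z : PrimalDual k n} (hz : IsLogCentralPoint A b c μ z) :
    b - A *ᵥ z.x = z.w := by
  rw [← hz.primal, add_sub_cancel_left]

theorem IsLogCentralPoint.gap_self {z : PrimalDual k n} (hz : IsLogCentralPoint A b c μ z) :
    c ⬝ᵥ z.x + z.y ⬝ᵥ b = (n + k) * μ := by
  have h1 : z.s ⬝ᵥ z.x = n * μ := by
    rw [dotProduct, Finset.sum_congr rfl fun j _ => (mul_comm _ _).trans (hz.compl_x j)]
    simp
  have h2 : z.y ⬝ᵥ z.w = k * μ := by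
    rw [dotProduct, Finset.sum_congr rfl fun j _ => (mul_comm _ _).trans (hz.compl_w j)]
    simp
  rw [← hz.gap, hz.w_eq, h1, h2]
  ring

theorem IsLogCentralPoint.dotProduct_le {z : PrimalDual k n} (hz : IsLogCentralPoint A b c μ z)
    (hb : 0 ≤ b) : c ⬝ᵥ z.x ≤ (n + k) * μ := by
  have h1 := hz.gap_self
  have h2 : 0 ≤ z.y ⬝ᵥ b := dotProduct_nonneg_of_nonneg (fun i => (hz.y_pos i).le) hb
  linarith

/-- Each product `s_j x_j` or `y_i (b - A x)_i` is at most the gap at `x`, which is at most `μ + (n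
+ k) μ`; complementarity turns division by `s_j` or `y_i` into a multiple of the central coordinate.
-/
theorem IsLogCentralPoint.le_mul {z : PrimalDual k n} (hz : IsLogCentralPoint A b c μ z)
    (hc : ∀ j, 0 ≤ c j) {x : Fin n → ℝ} (hx : 0 ≤ x) (hxA : A *ᵥ x ≤ b) (hcx : c ⬝ᵥ x ≤ μ) :
    (∀ j, x j ≤ (n + k + 1) * z.x j) ∧ ∀ i, b i - (A *ᵥ x) i ≤ (n + k + 1) * z.w i := by
  have h1 := hz.gap_self
  have h2 : 0 ≤ c ⬝ᵥ z.x := dotProduct_nonneg_of_nonneg hc fun j => (hz.x_pos j).le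
  have h3 := hz.gap x
  have hs : ∀ j, 0 ≤ z.s j * x j := fun j => mul_nonneg (hz.s_pos j).le (hx j)
  have hy : ∀ i, 0 ≤ z.y i * (b - A *ᵥ x) i := fun i =>
    mul_nonneg (hz.y_pos i).le (sub_nonneg.2 (hxA i))
  have hs0 : 0 ≤ z.s ⬝ᵥ x := Finset.sum_nonneg fun j _ => hs j
  have hy0 : 0 ≤ z.y ⬝ᵥ (b - A *ᵥ x) := Finset.sum_nonneg fun i _ => hy i
  refine ⟨fun j => ?_, fun i => ?_⟩
  · have h4 : z.s j * x j ≤ z.s ⬝ᵥ x :=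
      Finset.single_le_sum (f := fun j => z.s j * x j) (fun j _ => hs j) (Finset.mem_univ j)
    have h5 : z.s j * x j ≤ z.s j * ((n + k + 1) * z.x j) := by
      have := hz.compl_x j
      have h6 : z.s j * ((n + k + 1) * z.x j) = (n + k + 1) * μ := by rw [← this]; ring
      rw [h6]
      linarith
    exact le_of_mul_le_mul_left h5 (hz.s_pos j)
  · have h4 : z.y i * (b - A *ᵥ x) i ≤ z.y ⬝ᵥ (b - A *ᵥ x) :=
      Finset.single_le_sum (f := fun i => z.y i * (b - A *ᵥ x) i) (fun j _ => hy j)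
        (Finset.mem_univ i)
    have h5 : z.y i * (b - A *ᵥ x) i ≤ z.y i * ((n + k + 1) * z.w i) := by
      have := hz.compl_w i
      have h6 : z.y i * ((n + k + 1) * z.w i) = (n + k + 1) * μ := by rw [← this]; ring
      rw [h6]
      linarith
    exact le_of_mul_le_mul_left h5 (hz.y_pos i)

theorem mul_sub_nonpos_of_mul_eq {x s x' s' μ : ℝ} (hx : 0 < x) (hx' : 0 < x') (hμ : 0 < μ)
    (h : x * s = μ) (h' : x' * s' = μ) :
    (x - x') * (s - s') ≤ 0 ∧ ((x - x') * (s - s') = 0 → x = x') := by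
  have hs : s = μ / x := by rw [eq_div_iff hx.ne']; linarith
  have hs' : s' = μ / x' := by rw [eq_div_iff hx'.ne']; linarith
  have he : (x - x') * (s - s') = -(μ * (x - x') ^ 2 / (x * x')) := by
    rw [hs, hs']
    field_simp
    ring
  refine ⟨?_, fun h0 => ?_⟩
  · rw [he]
    exact neg_nonpos.2 (by positivity)
  · rw [he, neg_eq_zero, div_eq_zero_iff] at h0
    rcases h0 with h0 | h0
    · rcases mul_eq_zero.1 h0 with h1 | h1
      · exact absurd h1 hμ.ne'
      · exact sub_eq_zero.1 (pow_eq_zero_iff two_ne_zero |>.1 h1)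
    · exact absurd h0 (mul_pos hx hx').ne'

/-- Primal and dual differences are orthogonal, while every summand is nonpositive because `x ↦ μ /
x` is strictly decreasing; hence all summands vanish. -/
theorem IsLogCentralPoint.unique (hμ : 0 < μ) {z z' : PrimalDual k n}
    (hz : IsLogCentralPoint A b c μ z) (hz' : IsLogCentralPoint A b c μ z') : z = z' := by
  have hcross : (z.x - z'.x) ⬝ᵥ (z.s - z'.s) + (z.w - z'.w) ⬝ᵥ (z.y - z'.y) = 0 := by
    have hw : z.w - z'.w = -(A *ᵥ (z.x - z'.x)) := by
      rw [← hz.w_eq, ← hz'.w_eq, mulVec_sub]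
      abel
    have hs : z.s - z'.s = Aᵀ *ᵥ (z.y - z'.y) := by
      rw [mulVec_sub, sub_eq_sub_iff_sub_eq_sub.1 ((hz.dual.trans hz'.dual.symm))]
    rw [hw, hs, neg_dotProduct, dotProduct_mulVec, vecMul_transpose]
    ring
  have hX : ∀ j, (z.x - z'.x) j * (z.s - z'.s) j ≤ 0 := fun j =>
    (mul_sub_nonpos_of_mul_eq (hz.x_pos j) (hz'.x_pos j) hμ (hz.compl_x j) (hz'.compl_x j)).1
  have hW : ∀ i, (z.w - z'.w) i * (z.y - z'.y) i ≤ 0 := fun i =>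
    (mul_sub_nonpos_of_mul_eq (hz.w_pos i) (hz'.w_pos i) hμ (hz.compl_w i) (hz'.compl_w i)).1
  have hX0 : (z.x - z'.x) ⬝ᵥ (z.s - z'.s) ≤ 0 := Finset.sum_nonpos fun j _ => hX j
  have hW0 : (z.w - z'.w) ⬝ᵥ (z.y - z'.y) ≤ 0 := Finset.sum_nonpos fun j _ => hW j
  have hX1 : (z.x - z'.x) ⬝ᵥ (z.s - z'.s) = 0 := by linarith
  have hW1 : (z.w - z'.w) ⬝ᵥ (z.y - z'.y) = 0 := by linarith
  have hx : z.x = z'.x := funext fun j =>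
    (mul_sub_nonpos_of_mul_eq (hz.x_pos j) (hz'.x_pos j) hμ (hz.compl_x j) (hz'.compl_x j)).2
      ((Finset.sum_eq_zero_iff_of_nonpos fun j _ => hX j).1 hX1 j (Finset.mem_univ j))
  have hw : z.w = z'.w := funext fun j =>
    (mul_sub_nonpos_of_mul_eq (hz.w_pos j) (hz'.w_pos j) hμ (hz.compl_w j) (hz'.compl_w j)).2
      ((Finset.sum_eq_zero_iff_of_nonpos fun j _ => hW j).1 hW1 j (Finset.mem_univ j))
  have hs : z.s = z'.s := funext fun j => by
    have h1 := (hz.compl_x j).trans (hz'.compl_x j).symm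
    rw [hx] at h1
    exact mul_left_cancel₀ (hz'.x_pos j).ne' h1
  have hy : z.y = z'.y := funext fun j => by
    have h1 := (hz.compl_w j).trans (hz'.compl_w j).symm
    rw [hw] at h1
    exact mul_left_cancel₀ (hz'.w_pos j).ne' h1
  cases z
  cases z'
  simp only at hx hw hs hy
  rw [hx, hw, hs, hy]

theorem tendsto_pow_mul_exp_neg_mul (C δ : ℝ) (hδ : 0 < δ) (N : ℕ) :
    Tendsto (fun r : ℝ => (C * (1 + r)) ^ N * Real.exp (-(δ * r))) atTop (𝓝 0) := by
  have h1 : Tendsto (fun r : ℝ => δ * (1 + r)) atTop atTop :=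
    (tendsto_const_nhds.add_atTop tendsto_id : Tendsto (fun r : ℝ => 1 + id r) atTop atTop)
      |>.const_mul_atTop hδ
  have h2 := ((Real.tendsto_pow_mul_exp_neg_atTop_nhds_zero N).comp h1).const_mul
    ((C / δ) ^ N * Real.exp δ)
  rw [mul_zero] at h2
  refine h2.congr fun r => ?_
  have h3 : Real.exp (-(δ * r)) = Real.exp δ * Real.exp (-(δ * (1 + r))) := by
    rw [← Real.exp_add]; ring_nf
  rw [h3, show C * (1 + r) = (C / δ) * (δ * (1 + r)) by field_simp, mul_pow]
  simp only [Function.comp]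
  ring

/-- The exponential of the (negative, scaled) logarithmic barrier function. -/
noncomputable def expBarrier (A : Matrix (Fin k) (Fin n) ℝ) (b : Fin k → ℝ) (c : Fin n → ℝ) (μ : ℝ)
    (x : Fin n → ℝ) : ℝ :=
  (∏ j, x j) * (∏ i, (b - A *ᵥ x) i) * Real.exp (-(c ⬝ᵥ x / μ))

theorem continuous_expBarrier : Continuous (expBarrier A b c μ) := by
  have hA : Continuous fun x : Fin n → ℝ => A *ᵥ x := continuous_const.matrix_mulVec continuous_id
  have hA' : ∀ i, Continuous fun x : Fin n → ℝ => (b - A *ᵥ x) i := fun i =>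
    (continuous_apply i).comp (continuous_const.sub hA)
  have hc : Continuous fun x : Fin n → ℝ => c ⬝ᵥ x := continuous_const.dotProduct continuous_id
  unfold expBarrier
  fun_prop

/-- On the polyhedron each of the `n + k` factors grows at most linearly, whereas positivity of `c`
makes the exponential decay in `‖x‖`. This supplies the coercivity needed for a maximizer. -/
theorem tendsto_expBarrier (hc : ∀ j, 0 < c j) (hμ : 0 < μ) :
    Tendsto (expBarrier A b c μ) (cocompact (Fin n → ℝ) ⊓ 𝓟 {x | 0 ≤ x ∧ A *ᵥ x ≤ b})
      (𝓝 0) := by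
  obtain ⟨δ, hδ, hδc⟩ : ∃ δ, 0 < δ ∧ ∀ j, δ ≤ c j := by
    exact exists_lt_forall_le c 0 hc
  set C : ℝ := 1 + ∑ i, (|b i| + ∑ j, |A i j|) with hC
  have hin : ∀ i, |b i| + ∑ j, |A i j| ≤ C := by
    intro i
    have h1 : |b i| + ∑ j, |A i j| ≤ ∑ i, (|b i| + ∑ j, |A i j|) :=
      Finset.single_le_sum (f := fun i => |b i| + ∑ j, |A i j|)
        (fun i _ => by positivity) (Finset.mem_univ i)
    linarith
  have hC1 : 1 ≤ C := le_add_of_nonneg_right (by positivity)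
  have hbd : ∀ x ∈ {x : Fin n → ℝ | 0 ≤ x ∧ A *ᵥ x ≤ b}, ‖expBarrier A b c μ x‖ ≤
      (C * (1 + ‖x‖)) ^ (n + k) * Real.exp (-(δ / μ * ‖x‖)) := by
    rintro x ⟨hx, hxA⟩
    have hw : 0 ≤ b - A *ᵥ x := sub_nonneg.2 hxA
    have hxle : ∀ j, x j ≤ ‖x‖ := fun j => (le_abs_self _).trans (norm_le_pi_norm x j)
    have hn := norm_nonneg x
    have hp1 : ∏ j, x j ≤ (C * (1 + ‖x‖)) ^ n := by
      refine (Finset.prod_le_prod (fun j _ => hx j) (g := fun _ => C * (1 + ‖x‖))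
        fun j _ => ?_).trans (by simp)
      nlinarith [hxle j]
    have hp2 : ∏ i, (b - A *ᵥ x) i ≤ (C * (1 + ‖x‖)) ^ k := by
      refine (Finset.prod_le_prod (fun i _ => hw i) (g := fun _ => C * (1 + ‖x‖))
        fun i _ => ?_).trans (by simp)
      have h1 : |(A *ᵥ x) i| ≤ (∑ j, |A i j|) * ‖x‖ := by
        rw [mulVec, dotProduct, Finset.sum_mul]
        refine (Finset.abs_sum_le_sum_abs _ _).trans (Finset.sum_le_sum fun j _ => ?_)
        rw [abs_mul]
        exact mul_le_mul_of_nonneg_left (norm_le_pi_norm x j) (abs_nonneg _)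
      have h2 := neg_abs_le ((A *ᵥ x) i)
      have h3 := le_abs_self (b i)
      have h4 := hin i
      have h5 : 0 ≤ ∑ j, |A i j| := by positivity
      have h6 := abs_nonneg (b i)
      show b i - (A *ᵥ x) i ≤ _
      nlinarith
    have hcx : δ * ‖x‖ ≤ c ⬝ᵥ x := by
      have hcx0 : 0 ≤ c ⬝ᵥ x := dotProduct_nonneg_of_nonneg (fun j => (hc j).le) hx
      have : ‖x‖ ≤ c ⬝ᵥ x / δ := by
        refine (pi_norm_le_iff_of_nonneg (by positivity)).2 fun j => ?_
        rw [Real.norm_of_nonneg (hx j), le_div_iff₀ hδ]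
        have h1 : c j * x j ≤ c ⬝ᵥ x :=
          Finset.single_le_sum (f := fun j => c j * x j)
            (fun i _ => mul_nonneg (hc i).le (hx i)) (Finset.mem_univ j)
        nlinarith [hδc j, hx j, mul_le_mul_of_nonneg_right (hδc j) (hx j)]
      rw [le_div_iff₀ hδ] at this
      linarith
    have hp10 : 0 ≤ ∏ j, x j := Finset.prod_nonneg fun j _ => hx j
    have hp20 : 0 ≤ ∏ i, (b - A *ᵥ x) i := Finset.prod_nonneg fun j _ => hw j
    rw [expBarrier, Real.norm_of_nonneg (by positivity), pow_add]
    gcongr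
    rw [div_mul_eq_mul_div]
    gcongr
  refine squeeze_zero_norm' (a := fun x : Fin n → ℝ =>
    (C * (1 + ‖x‖)) ^ (n + k) * Real.exp (-(δ / μ * ‖x‖))) ?_ ?_
  · exact (eventually_principal.2 hbd).filter_mono inf_le_right
  · exact ((tendsto_pow_mul_exp_neg_mul C (δ / μ) (div_pos hδ hμ) (n + k)).comp
      (tendsto_norm_cocompact_atTop (E := Fin n → ℝ))).mono_left inf_le_left

/-- The function `expBarrier` attains its maximum on the closed polyhedron. It is positive at `x₀`
and zero where a coordinate or slack vanishes, so the maximizer is strictly feasible; the critical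
point equations of its logarithm, with `s = μ / x` and `y = μ / w`, are the dual equations. -/
theorem exists_isLogCentralPoint (hc : ∀ j, 0 < c j) (hμ : 0 < μ) {x₀ : Fin n → ℝ}
    (hx₀ : ∀ j, 0 < x₀ j) (hAx₀ : ∀ i, (A *ᵥ x₀) i < b i) :
    ∃ z, IsLogCentralPoint A b c μ z := by
  set S : Set (Fin n → ℝ) := {x | 0 ≤ x ∧ A *ᵥ x ≤ b} with hS
  have hA : Continuous fun x : Fin n → ℝ => A *ᵥ x := continuous_const.matrix_mulVec continuous_id
  have hSc : IsClosed S := (isClosed_le continuous_const continuous_id).inter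
    (isClosed_le hA continuous_const)
  have hG0 : 0 < expBarrier A b c μ x₀ := mul_pos (mul_pos (Finset.prod_pos fun j _ => hx₀ j)
    (Finset.prod_pos fun i _ => sub_pos.2 (hAx₀ i))) (Real.exp_pos _)
  obtain ⟨x, ⟨hx, hxA⟩, hmax⟩ := continuous_expBarrier.continuousOn.exists_isMaxOn' hSc
    (x₀ := x₀) ⟨fun j => (hx₀ j).le, fun i => (hAx₀ i).le⟩
    ((tendsto_expBarrier (A := A) (b := b) hc hμ).eventually (ge_mem_nhds hG0))
  have hGx : 0 < expBarrier A b c μ x :=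
    hG0.trans_le (hmax ⟨fun j => (hx₀ j).le, fun i => (hAx₀ i).le⟩)
  set w := b - A *ᵥ x with hw
  have hprod : (∏ j, x j) * (∏ i, w i) ≠ 0 := fun h => by
    rw [expBarrier, ← hw, h, zero_mul] at hGx
    exact lt_irrefl _ hGx
  have hxpos : ∀ j, 0 < x j := fun j => lt_of_le_of_ne (hx j) fun h =>
    hprod (by rw [Finset.prod_eq_zero (Finset.mem_univ j) h.symm, zero_mul])
  have hwpos : ∀ i, 0 < w i := fun i => lt_of_le_of_ne (sub_nonneg.2 (hxA i)) fun h =>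
    hprod (by rw [Finset.prod_eq_zero (Finset.mem_univ i) h.symm, mul_zero])
  have hcrit : ∀ j, (x j)⁻¹ + ∑ i, -A i j / w i - c j / μ = 0 := by
    intro j
    set ψ : ℝ → ℝ := fun s => (∑ l, Real.log (x l + s * (Pi.single j 1 : Fin n → ℝ) l)) +
      (∑ i, Real.log (w i - s * A i j)) - (c ⬝ᵥ x + s * c j) / μ with hψ
    have hd : HasDerivAt ψ ((∑ l, (Pi.single j 1 : Fin n → ℝ) l / x l) +
        (∑ i, -A i j / w i) - c j / μ) 0 := by
      refine HasDerivAt.sub (HasDerivAt.add (HasDerivAt.fun_sum fun l _ => ?_)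
        (HasDerivAt.fun_sum fun i _ => ?_)) ?_
      · have h1 : HasDerivAt (fun s : ℝ => x l + s * (Pi.single j 1 : Fin n → ℝ) l)
            ((Pi.single j 1 : Fin n → ℝ) l) 0 := by
          simpa using ((hasDerivAt_id (0 : ℝ)).mul_const _).const_add (x l)
        simpa using h1.log (by simpa using (hxpos l).ne')
      · have h1 : HasDerivAt (fun s : ℝ => w i - s * A i j) (-A i j) 0 := by
          simpa using ((hasDerivAt_id (0 : ℝ)).mul_const _).const_sub (w i)
        simpa using h1.log (by simpa using (hwpos i).ne')
      · have h1 : HasDerivAt (fun s : ℝ => c ⬝ᵥ x + s * c j) (c j) 0 := by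
          simpa using ((hasDerivAt_id (0 : ℝ)).mul_const _).const_add (c ⬝ᵥ x)
        exact h1.div_const μ
    have hloc : IsLocalMax ψ 0 := by
      have e1 : ∀ l, ∀ᶠ s in 𝓝 (0 : ℝ), 0 < x l + s * (Pi.single j 1 : Fin n → ℝ) l := fun l =>
        ContinuousAt.eventually_lt continuousAt_const (by fun_prop) (by simpa using hxpos l)
      have e2 : ∀ i, ∀ᶠ s in 𝓝 (0 : ℝ), 0 < w i - s * A i j := fun i =>
        ContinuousAt.eventually_lt continuousAt_const (by fun_prop) (by simpa using hwpos i)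
      have hb : ∀ s : ℝ, b - A *ᵥ (x + s • Pi.single j 1) = fun i => w i - s * A i j := by
        intro s
        ext i
        rw [mulVec_add, mulVec_smul, mulVec_single_one]
        simp only [hw, Pi.sub_apply, Pi.add_apply, Pi.smul_apply, col_apply, smul_eq_mul]
        ring
      have hlog : ∀ s : ℝ, (∀ l, 0 < x l + s * (Pi.single j 1 : Fin n → ℝ) l) →
          (∀ i, 0 < w i - s * A i j) → (x + s • Pi.single j 1 ∈ S ∧
            ψ s = Real.log (expBarrier A b c μ (x + s • Pi.single j 1))) := by
        intro s h1 h2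
        refine ⟨⟨fun l => (h1 l).le, sub_nonneg.1 ?_⟩, ?_⟩
        · rw [hb s]; exact fun i => (h2 i).le
        · rw [expBarrier, hb s, Real.log_mul, Real.log_mul, Real.log_exp, Real.log_prod,
            Real.log_prod, dotProduct_add, dotProduct_smul]
          · simp [hψ, sub_eq_add_neg]
          · exact fun i _ => (h2 i).ne'
          · exact fun l _ => (h1 l).ne'
          · exact (Finset.prod_pos fun l _ => h1 l).ne'
          · exact (Finset.prod_pos fun l _ => h2 l).ne'
          · exact (mul_pos (Finset.prod_pos fun l _ => h1 l)
              (Finset.prod_pos fun l _ => h2 l)).ne'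
          · exact (Real.exp_pos _).ne'
      filter_upwards [eventually_all.2 e1, eventually_all.2 e2] with s h1 h2
      obtain ⟨hmem, hs⟩ := hlog s h1 h2
      have h0 := (hlog 0 (by simpa using hxpos) (by simpa using hwpos)).2
      rw [zero_smul, add_zero] at h0
      rw [hs, h0]
      refine Real.log_le_log ?_ (hmax hmem)
      rw [expBarrier, hb s]
      exact mul_pos (mul_pos (Finset.prod_pos fun l _ => h1 l)
        (Finset.prod_pos fun l _ => h2 l)) (Real.exp_pos _)
    have := hloc.hasDerivAt_eq_zero hd
    rw [← this, Finset.sum_eq_single j (fun l _ hl => by simp [hl]) (by simp)]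
    simp
  refine ⟨⟨x, w, fun j => μ / x j, fun i => μ / w i⟩, ?_, ?_, fun j => ?_, fun i => ?_, hxpos, hwpos,
    fun j => div_pos hμ (hxpos j), fun i => div_pos hμ (hwpos i)⟩
  · simp [hw]
  · ext j
    have h1 := hcrit j
    have h2 : (Aᵀ *ᵥ fun i => μ / w i) j = -(μ * ∑ i, -A i j / w i) := by
      rw [mulVec, dotProduct, Finset.mul_sum, ← Finset.sum_neg_distrib]
      refine Finset.sum_congr rfl fun i _ => ?_
      rw [transpose_apply]
      ring
    show μ / x j - (Aᵀ *ᵥ fun i => μ / w i) j = c j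
    rw [h2]
    have h3 : c j = μ * ((x j)⁻¹ + ∑ i, -A i j / w i) := by
      have : c j / μ = (x j)⁻¹ + ∑ i, -A i j / w i := by linarith
      rw [← this]
      field_simp
    rw [h3]
    ring
  · exact mul_div_cancel₀ _ (hxpos j).ne'
  · exact mul_div_cancel₀ _ (hwpos i).ne'

end LogCentral

/-! ### The entropic central path of a real linear program -/

section Entropic

open MeasureTheory ProbabilityTheory

variable {n : ℕ} {P : Set (Fin n → ℝ)} {θ : Fin n → ℝ}

theorem continuous_dotProduct_left (θ : Fin n → ℝ) : Continuous fun x : Fin n → ℝ => θ ⬝ᵥ x :=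
  continuous_const.dotProduct continuous_id

/-- On the nonnegative orthant the integrand is a product of integrable exponentials in one
variable. -/
theorem integrableOn_exp_dotProduct (hPm : MeasurableSet P) (hnn : ∀ x ∈ P, 0 ≤ x)
    (hθ : ∀ j, θ j < 0) : IntegrableOn (fun x => Real.exp (θ ⬝ᵥ x)) P := by
  have h1 : Integrable (fun x : Fin n → ℝ =>
      ∏ j, (Set.Ici (0 : ℝ)).indicator (fun r => Real.exp (θ j * r)) (x j)) := by
    refine Integrable.fintype_prod (f := fun j =>
      (Set.Ici (0 : ℝ)).indicator (fun r => Real.exp (θ j * r))) fun j => ?_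
    rw [integrable_indicator_iff measurableSet_Ici, integrableOn_Ici_iff_integrableOn_Ioi]
    exact integrableOn_exp_mul_Ioi (hθ j) 0
  refine (h1.integrableOn (s := P)).congr_fun (fun x hx => ?_) hPm
  simp only
  rw [dotProduct, Real.exp_sum]
  exact Finset.prod_congr rfl fun j _ => Set.indicator_of_mem (show x j ∈ Set.Ici (0 : ℝ) from
    hnn x hx j) _

theorem neZero_restrict_of_interior (hpos : (interior P).Nonempty) :
    NeZero (volume.restrict P : Measure (Fin n → ℝ)) := by
  refine ⟨fun h => ?_⟩
  rw [Measure.restrict_eq_zero] at h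
  exact (isOpen_interior.measure_pos volume hpos).ne'
    (measure_mono_null interior_subset h)

/-- The probability measure on `P` with density proportional to `exp ⟨θ, x⟩`. -/
noncomputable abbrev gibbs (P : Set (Fin n → ℝ)) (θ : Fin n → ℝ) : Measure (Fin n → ℝ) :=
  (volume.restrict P).tilted fun x => θ ⬝ᵥ x

/-- The mean of the probability measure on `P` with density proportional to `exp ⟨θ, x⟩`. -/
noncomputable def gibbsMean (P : Set (Fin n → ℝ)) (θ : Fin n → ℝ) : Fin n → ℝ :=
  fun j => ∫ x, x j ∂gibbs P θ

theorem add_smul_single_neg (hθ : ∀ j, θ j < 0) {j : Fin n} {s : ℝ} (hs : s < -θ j) (l : Fin n) :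
    (θ + s • (Pi.single j 1 : Fin n → ℝ)) l < 0 := by
  by_cases h : l = j
  · subst h
    simp only [Pi.add_apply, Pi.smul_apply, Pi.single_eq_same, smul_eq_mul]
    linarith
  · simpa [h] using hθ l

/-- A small tilt along coordinate `j` keeps `θ` negative. This gives first moments and
differentiability of the moment generating function. -/
theorem zero_mem_interior_integrableExpSet (hPm : MeasurableSet P) (hnn : ∀ x ∈ P, 0 ≤ x)
    (hθ : ∀ j, θ j < 0) (j : Fin n) :
    0 ∈ interior (integrableExpSet (fun x : Fin n → ℝ => x j) (gibbs P θ)) := by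
  rw [mem_interior]
  refine ⟨Set.Iio (-θ j), fun s hs => ?_, isOpen_Iio, by simpa using hθ j⟩
  rw [integrableExpSet, Set.mem_ofPred_eq,
    integrable_tilted_iff (integrableOn_exp_dotProduct hPm hnn hθ)]
  have h1 := add_smul_single_neg hθ hs
  refine (integrableOn_exp_dotProduct hPm hnn h1).congr (ae_of_all _ fun x => ?_)
  simp only [smul_eq_mul]
  rw [← Real.exp_add, add_dotProduct, smul_dotProduct, single_one_dotProduct, smul_eq_mul]

theorem integrable_apply_gibbs (hPm : MeasurableSet P) (hnn : ∀ x ∈ P, 0 ≤ x)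
    (hθ : ∀ j, θ j < 0) (j : Fin n) : Integrable (fun x : Fin n → ℝ => x j) (gibbs P θ) :=
  memLp_one_iff_integrable.1
    (memLp_of_mem_interior_integrableExpSet (zero_mem_interior_integrableExpSet hPm hnn hθ j) 1)

theorem integrable_dotProduct_gibbs (hPm : MeasurableSet P) (hnn : ∀ x ∈ P, 0 ≤ x)
    (hθ : ∀ j, θ j < 0) (a : Fin n → ℝ) :
    Integrable (fun x : Fin n → ℝ => a ⬝ᵥ x) (gibbs P θ) :=
  integrable_finsetSum _ fun j _ => (integrable_apply_gibbs hPm hnn hθ j).const_mul (a j)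

theorem integral_dotProduct_gibbs (hPm : MeasurableSet P) (hnn : ∀ x ∈ P, 0 ≤ x)
    (hθ : ∀ j, θ j < 0) (a : Fin n → ℝ) :
    ∫ x, a ⬝ᵥ x ∂gibbs P θ = a ⬝ᵥ gibbsMean P θ := by
  simp only [dotProduct]
  rw [integral_finsetSum _ fun j _ => (integrable_apply_gibbs hPm hnn hθ j).const_mul (a j)]
  exact Finset.sum_congr rfl fun j _ => integral_const_mul _ _

theorem logLaplace_eq (hpos : (interior P).Nonempty)
    (hint : IntegrableOn (fun x => Real.exp (θ ⬝ᵥ x)) P) :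
    logLaplace P θ = (Real.log (∫ x in P, Real.exp (θ ⬝ᵥ x)) : ℝ) := by
  have := neZero_restrict_of_interior hpos
  rw [logLaplace, ← ofReal_integral_eq_lintegral_ofReal hint
    (ae_of_all _ fun x => (Real.exp_pos _).le), ENNReal.log_ofReal_of_pos (integral_exp_pos hint)]

theorem le_entropicBarrier (hpos : (interior P).Nonempty)
    (hint : IntegrableOn (fun x => Real.exp (θ ⬝ᵥ x)) P) (x : Fin n → ℝ) :
    ((θ ⬝ᵥ x - Real.log (∫ x in P, Real.exp (θ ⬝ᵥ x)) : ℝ) : EReal) ≤ entropicBarrier P x := by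
  refine le_trans (le_of_eq ?_) (le_iSup (fun θ : Fin n → ℝ =>
    ((θ ⬝ᵥ x : ℝ) : EReal) - logLaplace P θ) θ)
  rw [logLaplace_eq hpos hint, EReal.coe_sub]

theorem integral_exp_gibbs (θ' : Fin n → ℝ) :
    ∫ x, Real.exp ((θ' - θ) ⬝ᵥ x) ∂gibbs P θ =
      (∫ x in P, Real.exp (θ' ⬝ᵥ x)) / ∫ x in P, Real.exp (θ ⬝ᵥ x) := by
  rw [integral_exp_tilted]
  simp only [Pi.add_apply, ← add_dotProduct, add_sub_cancel]

/-- By Jensen's inequality for `exp` under the Gibbs measure, `θ` attains the supremum at its own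
mean; any `θ'` with divergent integral contributes `⊥`. -/
theorem entropicBarrier_gibbsMean (hPm : MeasurableSet P) (hnn : ∀ x ∈ P, 0 ≤ x)
    (hpos : (interior P).Nonempty) (hθ : ∀ j, θ j < 0) :
    entropicBarrier P (gibbsMean P θ) =
      (θ ⬝ᵥ gibbsMean P θ - Real.log (∫ x in P, Real.exp (θ ⬝ᵥ x)) : ℝ) := by
  have hint := integrableOn_exp_dotProduct hPm hnn hθ
  have hne := neZero_restrict_of_interior hpos
  have hprob : IsProbabilityMeasure (gibbs P θ) := isProbabilityMeasure_tilted hint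
  refine le_antisymm (iSup_le fun θ' => ?_) (le_entropicBarrier hpos hint _)
  by_cases hint' : IntegrableOn (fun x => Real.exp (θ' ⬝ᵥ x)) P
  · rw [logLaplace_eq hpos hint', ← EReal.coe_sub, EReal.coe_le_coe_iff]
    have hZ := integral_exp_pos hint
    have hZ' := integral_exp_pos hint'
    have hexp : Integrable (fun x => Real.exp ((θ' - θ) ⬝ᵥ x)) (gibbs P θ) := by
      rw [integrable_tilted_iff hint]
      refine hint'.congr (ae_of_all _ fun x => ?_)
      simp only [smul_eq_mul]
      rw [← Real.exp_add, ← add_dotProduct, add_sub_cancel]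
    have hJ := convexOn_exp.map_integral_le Real.continuous_exp.continuousOn isClosed_univ
      (ae_of_all _ fun x => Set.mem_univ _)
      (integrable_dotProduct_gibbs hPm hnn hθ (θ' - θ)) hexp
    rw [integral_dotProduct_gibbs hPm hnn hθ] at hJ
    have hJ' : Real.exp ((θ' - θ) ⬝ᵥ gibbsMean P θ) ≤
        (∫ x in P, Real.exp (θ' ⬝ᵥ x)) / ∫ x in P, Real.exp (θ ⬝ᵥ x) := by
      rw [← integral_exp_gibbs]
      exact hJ
    have hlog := (Real.le_log_iff_exp_le (div_pos hZ' hZ)).2 hJ'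
    rw [Real.log_div hZ'.ne' hZ.ne', sub_dotProduct] at hlog
    linarith
  · have htop : ∫⁻ x in P, ENNReal.ofReal (Real.exp (θ' ⬝ᵥ x)) = ⊤ := by
      by_contra hfin
      refine hint' ⟨(Real.continuous_exp.comp
        (continuous_dotProduct_left θ')).aestronglyMeasurable, ?_⟩
      rw [hasFiniteIntegral_iff_ofReal (ae_of_all _ fun x => (Real.exp_pos _).le)]
      exact lt_top_iff_ne_top.2 hfin
    rw [logLaplace, htop, ENNReal.log_top, EReal.sub_top]
    exact bot_le

/-- If `θ` attains the supremum at `x`, then the moment generating function of coordinate `j`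
dominates `exp (s * x j)` near `s = 0`, with equality at 0, so the derivatives there agree. -/
theorem eq_gibbsMean_of_entropicBarrier_le (hPm : MeasurableSet P) (hnn : ∀ x ∈ P, 0 ≤ x)
    (hpos : (interior P).Nonempty) (hθ : ∀ j, θ j < 0) {x : Fin n → ℝ}
    (hx : entropicBarrier P x ≤ (θ ⬝ᵥ x - Real.log (∫ x in P, Real.exp (θ ⬝ᵥ x)) : ℝ)) :
    x = gibbsMean P θ := by
  ext j
  have hint := integrableOn_exp_dotProduct hPm hnn hθ
  have hne := neZero_restrict_of_interior hpos
  have hprob : IsProbabilityMeasure (gibbs P θ) := isProbabilityMeasure_tilted hint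
  have hderiv := hasDerivAt_mgf (zero_mem_interior_integrableExpSet hPm hnn hθ j)
  have hd : HasDerivAt (fun s => mgf (fun x : Fin n → ℝ => x j) (gibbs P θ) s - Real.exp (s * x j))
      (gibbsMean P θ j - x j) 0 := by
    have h1 : HasDerivAt (fun s : ℝ => Real.exp (s * x j)) (x j) 0 := by
      simpa using ((hasDerivAt_id (0 : ℝ)).mul_const (x j)).exp
    refine HasDerivAt.sub ?_ h1
    simpa [gibbsMean] using hderiv
  have hmin : IsLocalMin
      (fun s => mgf (fun x : Fin n → ℝ => x j) (gibbs P θ) s - Real.exp (s * x j)) 0 := by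
    filter_upwards [Iio_mem_nhds (show (0 : ℝ) < -θ j by simpa using hθ j)] with s hs
    simp only [mgf_zero, zero_mul, Real.exp_zero, sub_self, sub_nonneg]
    have h1 := add_smul_single_neg hθ hs
    have hint' := integrableOn_exp_dotProduct hPm hnn h1
    have hZ := integral_exp_pos hint
    have hZ' := integral_exp_pos hint'
    have h2 := (le_entropicBarrier hpos hint' x).trans hx
    rw [EReal.coe_le_coe_iff, add_dotProduct, smul_dotProduct, single_one_dotProduct,
      smul_eq_mul] at h2
    have h3 : mgf (fun x : Fin n → ℝ => x j) (gibbs P θ) s =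
        (∫ x in P, Real.exp ((θ + s • Pi.single j 1) ⬝ᵥ x)) / ∫ x in P, Real.exp (θ ⬝ᵥ x) := by
      rw [← integral_exp_gibbs, mgf]
      simp only [add_sub_cancel_left, smul_dotProduct, single_one_dotProduct, smul_eq_mul]
    rw [h3, ← Real.le_log_iff_exp_le (div_pos hZ' hZ), Real.log_div hZ'.ne' hZ.ne']
    linarith
  have := hmin.hasDerivAt_eq_zero hd
  linarith

/-- With `θ = -c / μ` the objective is `μ` times the barrier minus `θ ⬝ᵥ y`. By the Fenchel
inequality it is at least `-μ log Z`, where `Z` is the integral of `exp (θ ⬝ᵥ x)` over `P`, with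
equality only at the Gibbs mean. -/
theorem isEntropicCentralPoint_iff {c : Fin n → ℝ} {μ : ℝ} (hPm : MeasurableSet P)
    (hnn : ∀ x ∈ P, 0 ≤ x) (hpos : (interior P).Nonempty) (hc : ∀ j, 0 < c j) (hμ : 0 < μ)
    (hmean : gibbsMean P (-(μ⁻¹ • c)) ∈ interior P) {x : Fin n → ℝ} :
    IsEntropicCentralPoint P c μ x ↔ x = gibbsMean P (-(μ⁻¹ • c)) := by
  set θ := -(μ⁻¹ • c) with hθdef
  have hθ : ∀ j, θ j < 0 := fun j => neg_neg_of_pos (mul_pos (inv_pos.2 hμ) (hc j))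
  have hint := integrableOn_exp_dotProduct hPm hnn hθ
  set ℓ := Real.log (∫ x in P, Real.exp (θ ⬝ᵥ x)) with hℓ
  have hθc : ∀ y : Fin n → ℝ, c ⬝ᵥ y + μ * (θ ⬝ᵥ y - ℓ) = -(μ * ℓ) := by
    intro y
    rw [hθdef, neg_dotProduct, smul_dotProduct, smul_eq_mul]
    field_simp
    ring
  have hge : ∀ y : Fin n → ℝ, ((-(μ * ℓ) : ℝ) : EReal) ≤
      ((c ⬝ᵥ y : ℝ) : EReal) + (μ : EReal) * entropicBarrier P y := by
    intro y
    rw [← hθc y, EReal.coe_add, EReal.coe_mul]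
    gcongr
    exact le_entropicBarrier hpos hint y
  have heq : ((c ⬝ᵥ gibbsMean P θ : ℝ) : EReal) +
      (μ : EReal) * entropicBarrier P (gibbsMean P θ) = ((-(μ * ℓ) : ℝ) : EReal) := by
    rw [entropicBarrier_gibbsMean hPm hnn hpos hθ, ← EReal.coe_mul, ← EReal.coe_add, hθc]
  constructor
  · rintro ⟨-, hx⟩
    have h1 : ((c ⬝ᵥ x : ℝ) : EReal) + (μ : EReal) * entropicBarrier P x ≤
        ((-(μ * ℓ) : ℝ) : EReal) := heq ▸ hx hmean
    refine eq_gibbsMean_of_entropicBarrier_le hPm hnn hpos hθ ?_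
    induction h : entropicBarrier P x with
    | bot => exact bot_le
    | top =>
      rw [h, EReal.coe_mul_top_of_pos hμ, EReal.coe_add_top] at h1
      exact absurd h1 (not_le.2 (EReal.coe_lt_top _))
    | coe r =>
      rw [h, ← EReal.coe_mul, ← EReal.coe_add, EReal.coe_le_coe_iff, ← hθc x] at h1
      rw [EReal.coe_le_coe_iff]
      exact le_of_mul_le_mul_left (by linarith) hμ
  · rintro rfl
    exact ⟨hmean, isMinOn_iff.2 fun y _ => heq.trans_le (hge y)⟩

/-- The contraction by one half towards `y` maps `P` into itself and has Jacobian `2 ^ (-n)`. -/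
theorem setIntegral_le_of_le_comp_midpoint (hPm : MeasurableSet P) (hconv : Convex ℝ P)
    {y : Fin n → ℝ} (hy : y ∈ P) {f G : (Fin n → ℝ) → ℝ} (hG : ∀ x ∈ P, 0 ≤ G x)
    (hint : IntegrableOn G P) (hf : ∀ x ∈ P, 0 ≤ f x)
    (hfG : ∀ x ∈ P, f x ≤ G ((1 / 2 : ℝ) • x + (1 / 2 : ℝ) • y)) :
    ∫ x in P, f x ≤ 2 ^ n * ∫ x in P, G x := by
  have h1 : ∫ x, P.indicator G ((1 / 2 : ℝ) • x + (1 / 2 : ℝ) • y) = 2 ^ n * ∫ x in P, G x := by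
    rw [Measure.integral_comp_smul volume
      (fun x => P.indicator G (x + (1 / 2 : ℝ) • y)) (1 / 2 : ℝ), integral_add_right_eq_self,
      integral_indicator hPm]
    simp
  rw [← h1, ← integral_indicator hPm]
  have hGi : Integrable (P.indicator G) := (integrable_indicator_iff hPm).2 hint
  have hi : Integrable fun x => P.indicator G ((1 / 2 : ℝ) • x + (1 / 2 : ℝ) • y) :=
    (hGi.comp_add_right ((1 / 2 : ℝ) • y)).comp_smul (by norm_num)
  have hmem : ∀ x ∈ P, (1 / 2 : ℝ) • x + (1 / 2 : ℝ) • y ∈ P := fun x hx =>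
    hconv hx hy (by norm_num) (by norm_num) (by norm_num)
  refine integral_mono_of_nonneg (ae_of_all _ fun x => ?_) hi (ae_of_all _ fun x => ?_)
  · exact Set.indicator_nonneg hf x
  · by_cases hx : x ∈ P
    · simp only [Set.indicator_of_mem hx, Set.indicator_of_mem (hmem x hx)]
      exact hfG x hx
    · simp only [Set.indicator_of_notMem hx]
      exact Set.indicator_nonneg hG _

end Entropic

/-! ### Gibbs means on polyhedra -/

section EntropicPolyhedron

open MeasureTheory ProbabilityTheory

variable {m n : ℕ} {A : Matrix (Fin m) (Fin n) ℝ} {b : Fin m → ℝ}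

theorem continuous_mulVec_left (A : Matrix (Fin m) (Fin n) ℝ) :
    Continuous fun x : Fin n → ℝ => A *ᵥ x := continuous_const.matrix_mulVec continuous_id

theorem isClosed_polyhedron : IsClosed (polyhedron A b) :=
  isClosed_le (continuous_mulVec_left A) continuous_const

theorem convex_polyhedron : Convex ℝ (polyhedron A b) := by
  intro x hx y hy s r hs hr hsr i
  have h1 := mul_le_mul_of_nonneg_left (hx i) hs
  have h2 := mul_le_mul_of_nonneg_left (hy i) hr
  rw [mulVec_add, mulVec_smul, mulVec_smul]
  show s * (A *ᵥ x) i + r * (A *ᵥ y) i ≤ b i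
  calc _ ≤ s * b i + r * b i := add_le_add h1 h2
    _ = b i := by rw [← add_mul, hsr, one_mul]

theorem mem_interior_polyhedron (hb : 0 ≤ b) {x : Fin n → ℝ}
    (hx : ∀ i, A i ≠ 0 → (A *ᵥ x) i < b i) : x ∈ interior (polyhedron A b) := by
  rw [mem_interior]
  refine ⟨⋂ i, {x | A i ≠ 0 → (A *ᵥ x) i < b i}, fun y hy i => ?_,
    isOpen_iInter_of_finite fun i => ?_, Set.mem_iInter.2 hx⟩
  · by_cases h : A i = 0
    · have : (A *ᵥ y) i = 0 := by rw [mulVec, h, zero_dotProduct]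
      rw [this]
      exact hb i
    · exact (Set.mem_iInter.1 hy i h).le
  · by_cases h : A i = 0
    · simp [h]
    · simp only [ne_eq, h, not_false_eq_true, forall_const]
      exact isOpen_lt ((continuous_apply i).comp (continuous_mulVec_left A)) continuous_const

theorem ae_mem_gibbs {P : Set (Fin n → ℝ)} (hPm : MeasurableSet P) (θ : Fin n → ℝ) :
    ∀ᵐ x ∂gibbs P θ, x ∈ P :=
  (tilted_absolutelyContinuous _ _).ae_le (ae_restrict_mem hPm)

/-- The slack of a nonzero row is nonnegative on `P` and positive on a nonempty open subset, so its
mean is positive. -/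
theorem gibbsMean_mem_interior (hb : 0 ≤ b) (hnn : ∀ x ∈ polyhedron A b, 0 ≤ x)
    {x₀ : Fin n → ℝ} (hx₀ : ∀ i, A i ≠ 0 → (A *ᵥ x₀) i < b i) {θ : Fin n → ℝ}
    (hθ : ∀ j, θ j < 0) : gibbsMean (polyhedron A b) θ ∈ interior (polyhedron A b) := by
  set P := polyhedron A b with hP
  have hPm : MeasurableSet P := isClosed_polyhedron.measurableSet
  have hx₀i : x₀ ∈ interior P := mem_interior_polyhedron hb hx₀
  have hint := integrableOn_exp_dotProduct hPm hnn hθ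
  have hne := neZero_restrict_of_interior ⟨x₀, hx₀i⟩
  have hprob : IsProbabilityMeasure (gibbs P θ) := isProbabilityMeasure_tilted hint
  refine mem_interior_polyhedron hb fun i hi => ?_
  have hI : Integrable (fun x : Fin n → ℝ => b i - A i ⬝ᵥ x) (gibbs P θ) :=
    (integrable_const _).sub (integrable_dotProduct_gibbs hPm hnn hθ (A i))
  have hval : ∫ x, (b i - A i ⬝ᵥ x) ∂gibbs P θ = b i - A i ⬝ᵥ gibbsMean P θ := by
    rw [integral_sub (integrable_const _) (integrable_dotProduct_gibbs hPm hnn hθ (A i)),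
      integral_dotProduct_gibbs hPm hnn hθ]
    simp
  have hpos : 0 < ∫ x, (b i - A i ⬝ᵥ x) ∂gibbs P θ := by
    have hge : 0 ≤ᵐ[gibbs P θ] fun x => b i - A i ⬝ᵥ x :=
      (ae_mem_gibbs hPm θ).mono fun x hx => sub_nonneg.2 (hx i)
    rw [integral_pos_iff_support_of_nonneg_ae hge hI, pos_iff_ne_zero]
    intro h0
    have h1 := absolutelyContinuous_tilted hint h0
    have hopen : IsOpen (interior P ∩ {x : Fin n → ℝ | A i ⬝ᵥ x < b i}) :=
      isOpen_interior.inter (isOpen_lt (continuous_dotProduct_left (A i)) continuous_const)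
    have h2 : 0 < volume (interior P ∩ {x : Fin n → ℝ | A i ⬝ᵥ x < b i}) :=
      hopen.measure_pos volume ⟨x₀, hx₀i, hx₀ i hi⟩
    rw [Measure.restrict_apply' hPm] at h1
    refine h2.ne' (measure_mono_null ?_ h1)
    rintro x ⟨hxP, hx⟩
    have hx' : A i ⬝ᵥ x < b i := hx
    exact ⟨(sub_pos.2 hx').ne', interior_subset hxP⟩
  rw [hval] at hpos
  exact sub_pos.1 hpos

/-- Contracting towards 0 shows that halving `θ` multiplies the partition function by at most `2 ^
n`, and `u * exp (-u) ≤ 2 * exp (-u / 2)` then bounds the mean cost. Contracting towards `y` lands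
at points whose `j`-th coordinate is at least `y j / 2`, at the price of a factor `exp (θ ⬝ᵥ y / 2)
≥ 1 / 2`; together with `2 ^ n` this makes `2 ^ (n + 2)`. -/
theorem gibbsMean_bounds {P : Set (Fin n → ℝ)} (hPm : MeasurableSet P) (hconv : Convex ℝ P)
    (h0 : 0 ∈ P) (hnn : ∀ x ∈ P, 0 ≤ x) (hpos : (interior P).Nonempty) {c : Fin n → ℝ} {μ : ℝ}
    (hc : ∀ j, 0 < c j) (hμ : 0 < μ) :
    c ⬝ᵥ gibbsMean P (-(μ⁻¹ • c)) ≤ 2 ^ (n + 2) * μ ∧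
      ∀ y ∈ P, c ⬝ᵥ y ≤ μ → ∀ j, y j ≤ 2 ^ (n + 2) * gibbsMean P (-(μ⁻¹ • c)) j := by
  set θ := -(μ⁻¹ • c) with hθdef
  have hθ : ∀ j, θ j < 0 := fun j => neg_neg_of_pos (mul_pos (inv_pos.2 hμ) (hc j))
  have hint := integrableOn_exp_dotProduct hPm hnn hθ
  have hne := neZero_restrict_of_interior hpos
  set Z := ∫ x in P, Real.exp (θ ⬝ᵥ x) with hZdef
  have hZ : 0 < Z := integral_exp_pos hint
  have hθ2 : ∀ j, ((1 / 2 : ℝ) • θ) j < 0 := fun j =>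
    mul_neg_of_pos_of_neg (by norm_num) (hθ j)
  have hint2 := integrableOn_exp_dotProduct hPm hnn hθ2
  set J := ∫ x in P, Real.exp (((1 / 2 : ℝ) • θ) ⬝ᵥ x) with hJdef
  have hJZ : J ≤ 2 ^ n * Z := by
    refine setIntegral_le_of_le_comp_midpoint hPm hconv h0 (fun x _ => (Real.exp_pos _).le) hint
      (fun x _ => (Real.exp_pos _).le) fun x _ => le_of_eq ?_
    rw [smul_zero, add_zero, dotProduct_smul, smul_dotProduct]
  have hZJ : Z ≤ J := by
    refine setIntegral_mono_on hint hint2 hPm fun x hx => Real.exp_le_exp.2 ?_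
    have : θ ⬝ᵥ x ≤ 0 := Finset.sum_nonpos fun j _ =>
      mul_nonpos_of_nonpos_of_nonneg (hθ j).le (hnn x hx j)
    rw [smul_dotProduct, smul_eq_mul]
    linarith
  have hmoment : ∀ a : Fin n → ℝ, a ⬝ᵥ gibbsMean P θ =
      (∫ x in P, (a ⬝ᵥ x) * Real.exp (θ ⬝ᵥ x)) / Z := by
    intro a
    rw [← integral_dotProduct_gibbs hPm hnn hθ, integral_tilted, ← integral_div]
    refine integral_congr_ae (ae_of_all _ fun x => ?_)
    simp only [smul_eq_mul]
    rw [hZdef]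
    ring
  have hminteg : ∀ a : Fin n → ℝ, IntegrableOn (fun x => (a ⬝ᵥ x) * Real.exp (θ ⬝ᵥ x)) P := by
    intro a
    have := (integrable_tilted_iff hint _).1 (integrable_dotProduct_gibbs hPm hnn hθ a)
    refine this.congr (ae_of_all _ fun x => ?_)
    simp only [smul_eq_mul]
    ring
  have hcθ : ∀ x, c ⬝ᵥ x = -(μ * (θ ⬝ᵥ x)) := by
    intro x
    rw [hθdef, neg_dotProduct, smul_dotProduct, smul_eq_mul]
    field_simp
  refine ⟨?_, fun y hy hcy j => ?_⟩
  · rw [hmoment, div_le_iff₀ hZ]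
    have h1 : ∫ x in P, (c ⬝ᵥ x) * Real.exp (θ ⬝ᵥ x) ≤
        ∫ x in P, 2 * μ * Real.exp (((1 / 2 : ℝ) • θ) ⬝ᵥ x) := by
      refine setIntegral_mono_on (hminteg c) (hint2.const_mul _) hPm fun x hx => ?_
      rw [hcθ, smul_dotProduct, smul_eq_mul]
      set u := θ ⬝ᵥ x
      have h2 : Real.exp u = Real.exp (1 / 2 * u) * Real.exp (1 / 2 * u) := by
        rw [← Real.exp_add]; ring_nf
      have h3 : -u / 2 * Real.exp (1 / 2 * u) ≤ 1 := by
        have h4 := Real.add_one_le_exp (-(1 / 2 * u))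
        have h5 : Real.exp (-(1 / 2 * u)) * Real.exp (1 / 2 * u) = 1 := by
          rw [← Real.exp_add, neg_add_cancel, Real.exp_zero]
        exact (mul_le_mul_of_nonneg_right (by linarith) (Real.exp_pos _).le).trans_eq h5
      rw [h2]
      have h6 := mul_le_mul_of_nonneg_right h3 (Real.exp_pos (1 / 2 * u)).le
      nlinarith
    rw [integral_const_mul] at h1
    have h2 : 2 * μ * J ≤ 2 * μ * (2 ^ n * Z) := mul_le_mul_of_nonneg_left hJZ (by positivity)
    have h3 : 2 * μ * (2 ^ n * Z) ≤ 2 ^ (n + 2) * μ * Z := by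
      rw [pow_add]
      have : 0 ≤ μ * (2 ^ n * Z) := by positivity
      nlinarith
    linarith
  · have hm := hmoment (Pi.single j 1)
    rw [single_one_dotProduct] at hm
    have hy0 : 0 ≤ y j := hnn y hy j
    have hθy : -1 ≤ θ ⬝ᵥ y := by
      rw [hcθ] at hcy
      by_contra hlt
      nlinarith [mul_lt_mul_of_pos_left (not_le.1 hlt) hμ]
    have hexp : (1 / 2 : ℝ) ≤ Real.exp (1 / 2 * (θ ⬝ᵥ y)) := by
      have := Real.add_one_le_exp (1 / 2 * (θ ⬝ᵥ y))
      linarith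
    have hmid : ∫ x in P, y j / 4 * Real.exp (((1 / 2 : ℝ) • θ) ⬝ᵥ x) ≤
        2 ^ n * ∫ x in P, ((Pi.single j 1 : Fin n → ℝ) ⬝ᵥ x) * Real.exp (θ ⬝ᵥ x) := by
      refine setIntegral_le_of_le_comp_midpoint hPm hconv hy (fun x hx => ?_) (hminteg _)
        (fun x _ => by positivity) fun x hx => ?_
      · rw [single_one_dotProduct]
        exact mul_nonneg (hnn x hx j) (Real.exp_pos _).le
      · have hxj : 0 ≤ x j := hnn x hx j
        rw [single_one_dotProduct, dotProduct_add, dotProduct_smul, dotProduct_smul,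
          Real.exp_add, smul_dotProduct]
        simp only [Pi.add_apply, Pi.smul_apply, smul_eq_mul]
        have h1 : y j / 4 ≤ (1 / 2 * x j + 1 / 2 * y j) * Real.exp (1 / 2 * (θ ⬝ᵥ y)) :=
          calc y j / 4 = (1 / 2 * y j) * (1 / 2) := by ring
            _ ≤ _ := mul_le_mul (by linarith) hexp (by norm_num) (by positivity)
        calc _ ≤ (1 / 2 * x j + 1 / 2 * y j) * Real.exp (1 / 2 * (θ ⬝ᵥ y)) *
              Real.exp (1 / 2 * (θ ⬝ᵥ x)) := mul_le_mul_of_nonneg_right h1 (Real.exp_pos _).le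
          _ = _ := by ring
    rw [integral_const_mul] at hmid
    have h2 : y j / 4 * Z ≤ y j / 4 * J := mul_le_mul_of_nonneg_left hZJ (by positivity)
    rw [eq_div_iff hZ.ne'] at hm
    rw [← hm] at hmid
    have h3 : y j / 4 * Z ≤ 2 ^ n * gibbsMean P θ j * Z := by
      rw [mul_assoc]
      exact h2.trans hmid
    have h4 := le_of_mul_le_mul_right h3 hZ
    rw [pow_add]
    linarith

end EntropicPolyhedron

/-! ### Log-limits of the two central paths -/

theorem tendsto_logb_of_comparable {f g : ℝ → ℝ} {κ e : ℝ} (hg : ∀ᶠ t in atTop, 0 < g t)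
    (h1 : ∀ᶠ t in atTop, g t ≤ κ * f t) (h2 : ∀ᶠ t in atTop, f t ≤ κ * g t) (hκ : 0 < κ)
    (he : Tendsto (fun t => Real.logb t (g t)) atTop (𝓝 e)) :
    Tendsto (fun t => Real.logb t (f t)) atTop (𝓝 e) := by
  have hk : Tendsto (fun t => Real.logb t κ) atTop (𝓝 0) :=
    tendsto_const_nhds.div_atTop Real.tendsto_log_atTop
  have hf : ∀ᶠ t in atTop, 0 < f t := by
    filter_upwards [hg, h1] with t ht h
    exact pos_of_mul_pos_right (ht.trans_le h) hκ.le
  have hlo : Tendsto (fun t => Real.logb t (g t) - Real.logb t κ) atTop (𝓝 e) := by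
    simpa using he.sub hk
  have hhi : Tendsto (fun t => Real.logb t κ + Real.logb t (g t)) atTop (𝓝 e) := by
    simpa using hk.add he
  refine tendsto_of_tendsto_of_tendsto_of_le_of_le' hlo hhi ?_ ?_
  · filter_upwards [hg, hf, h1, eventually_gt_atTop 1] with t ht htf h ht1
    rw [sub_le_iff_le_add, add_comm, ← Real.logb_mul hκ.ne' htf.ne']
    exact Real.logb_le_logb_of_le ht1 ht h
  · filter_upwards [hg, hf, h2, eventually_gt_atTop 1] with t ht htf h ht1
    rw [← Real.logb_mul hκ.ne' ht.ne']
    exact Real.logb_le_logb_of_le ht1 htf h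

/-- The point `κ⁻¹ • x` lies in the sublevel set because `b ≥ 0`, and `β ≥ 0` makes the affine
functional lose at most the factor `κ`. -/
theorem le_mul_of_isGreatest_sublevel {n : ℕ} {ι : Type*} {A : Matrix ι (Fin n) ℝ} {b : ι → ℝ}
    {c a : Fin n → ℝ} {μ β κ M : ℝ} (hb : 0 ≤ b) (hβ : 0 ≤ β) (hκ : 1 ≤ κ)
    (hM : IsGreatest ((fun x => a ⬝ᵥ x + β) '' lpSublevel A b c μ) M) {x : Fin n → ℝ}
    (hx : A *ᵥ x ≤ b) (hcx : c ⬝ᵥ x ≤ κ * μ) : a ⬝ᵥ x + β ≤ κ * M := by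
  have hκ0 : 0 < κ := one_pos.trans_le hκ
  have hκi : κ⁻¹ ≤ 1 := inv_le_one_of_one_le₀ hκ
  have hmem : κ⁻¹ • x ∈ lpSublevel A b c μ := by
    refine ⟨fun i => ?_, ?_⟩
    · rw [mulVec_smul]
      show κ⁻¹ * (A *ᵥ x) i ≤ b i
      have h1 := mul_le_mul_of_nonneg_left (hx i) (inv_pos.2 hκ0).le
      have h2 := mul_le_mul_of_nonneg_right hκi (hb i)
      linarith
    · rw [dotProduct_smul, smul_eq_mul, inv_mul_le_iff₀ hκ0]
      exact hcx
  have h1 : a ⬝ᵥ (κ⁻¹ • x) + β ≤ M := hM.2 ⟨_, hmem, rfl⟩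
  rw [dotProduct_smul, smul_eq_mul] at h1
  have h2 : κ * (κ⁻¹ * (a ⬝ᵥ x) + β) ≤ κ * M := mul_le_mul_of_nonneg_left h1 hκ0.le
  rw [mul_add, ← mul_assoc, mul_inv_cancel₀ hκ0.ne', one_mul] at h2
  nlinarith

/-- Midpoints of witnesses for single inequalities stay strict wherever either endpoint is. -/
theorem exists_forall_dotProduct_lt {K : Type*} [Field K] [LinearOrder K] [IsStrictOrderedRing K]
    {n : ℕ} {P : Set (Fin n → K)} (hmid : ∀ x ∈ P, ∀ y ∈ P, (1 / 2 : K) • x + (1 / 2 : K) • y ∈ P)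
    (hne : P.Nonempty) {ι : Type*} [Finite ι] (a : ι → Fin n → K) (β : ι → K)
    (hle : ∀ i, ∀ x ∈ P, a i ⬝ᵥ x ≤ β i) (hlt : ∀ i, ∃ x ∈ P, a i ⬝ᵥ x < β i) :
    ∃ x ∈ P, ∀ i, a i ⬝ᵥ x < β i := by
  classical
  have := Fintype.ofFinite ι
  have key : ∀ s : Finset ι, ∃ x ∈ P, ∀ i ∈ s, a i ⬝ᵥ x < β i := by
    intro s
    induction s using Finset.induction_on with
    | empty => exact ⟨hne.some, hne.some_mem, by simp⟩
    | insert i s _ ih =>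
      obtain ⟨x, hx, hxs⟩ := ih
      obtain ⟨y, hy, hyi⟩ := hlt i
      refine ⟨_, hmid x hx y hy, fun l hl => ?_⟩
      rw [dotProduct_add, dotProduct_smul, dotProduct_smul, smul_eq_mul, smul_eq_mul]
      rcases Finset.mem_insert.1 hl with rfl | hl
      · linarith [hle l x hx]
      · linarith [hle l y hy, hxs l hl]
  obtain ⟨x, hx, h⟩ := key Finset.univ
  exact ⟨x, hx, fun i => h i (Finset.mem_univ i)⟩

/-! ### Consequences of the standing assumption, over the series and for large `t` -/

namespace TropAssumption

variable {m n : ℕ} {A : Matrix (Fin m) (Fin n) Puiseux} {b : Fin m → Puiseux}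
  {c : Fin n → Puiseux}

theorem rhs_nonneg (hP : TropAssumption (polyhedron A b) c) : 0 ≤ b := by
  have : A *ᵥ (0 : Fin n → Puiseux) ≤ b := hP.zero_mem
  rwa [mulVec_zero] at this

theorem interior_nonempty {P : Set (Fin n → Puiseux)} (hP : TropAssumption P c) :
    (interior ((fun (x : Fin n → Puiseux) i => (x i).val) '' P)).Nonempty := by
  rw [← closure_nonempty_iff, ← hP.regular]
  exact ⟨_, 0, hP.zero_mem, rfl⟩

/-- If `β > 0` the origin is strict; if `β = 0` the functional cannot vanish on all of `P`. -/
theorem exists_dotProduct_lt {P : Set (Fin n → Puiseux)} (hP : TropAssumption P c)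
    {a : Fin n → Puiseux} {β : Puiseux} (h : a ≠ 0 ∨ β ≠ 0) (hle : ∀ x ∈ P, a ⬝ᵥ x ≤ β) :
    ∃ x ∈ P, a ⬝ᵥ x < β := by
  have hβ : 0 ≤ β := by simpa using hle 0 hP.zero_mem
  rcases hβ.eq_or_lt with h0 | h0
  · obtain ⟨x, hx, hne⟩ := Puiseux.exists_dotProduct_ne_zero hP.interior_nonempty
      (h.resolve_right fun hn => hn h0.symm)
    exact ⟨x, hx, lt_of_le_of_ne (hle x hx) (h0 ▸ hne)⟩
  · exact ⟨0, hP.zero_mem, by simpa using h0⟩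

theorem midpoint_mem (x : Fin n → Puiseux) (hx : x ∈ polyhedron A b) (y : Fin n → Puiseux)
    (hy : y ∈ polyhedron A b) :
    (1 / 2 : Puiseux) • x + (1 / 2 : Puiseux) • y ∈ polyhedron A b := by
  intro i
  rw [mulVec_add, mulVec_smul, mulVec_smul]
  show (1 / 2 : Puiseux) * (A *ᵥ x) i + (1 / 2 : Puiseux) * (A *ᵥ y) i ≤ b i
  linarith [hx i, hy i]

theorem exists_strict (hP : TropAssumption (polyhedron A b) c) {ι : Type*} [Finite ι]
    (a : ι → Fin n → Puiseux) (β : ι → Puiseux) (hne : ∀ i, a i ≠ 0 ∨ β i ≠ 0)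
    (hle : ∀ i, ∀ x ∈ polyhedron A b, a i ⬝ᵥ x ≤ β i) :
    ∃ x ∈ polyhedron A b, ∀ i, a i ⬝ᵥ x < β i :=
  exists_forall_dotProduct_lt midpoint_mem ⟨0, hP.zero_mem⟩ a β hle fun i =>
    hP.exists_dotProduct_lt (hne i) (hle i)

theorem eventually_exists_strict (hP : TropAssumption (polyhedron A b) c) {ι : Type*} [Finite ι]
    (a : ι → Fin n → Puiseux) (β : ι → Puiseux) (hne : ∀ i, a i ≠ 0 ∨ β i ≠ 0)
    (hle : ∀ i, ∀ x ∈ polyhedron A b, a i ⬝ᵥ x ≤ β i) :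
    ∀ᶠ t in atTop, ∃ x : Fin n → ℝ, ∀ i,
      (fun j => (a i j).eval t) ⬝ᵥ x < (β i).eval t := by
  obtain ⟨x, -, hx⟩ := hP.exists_strict a β hne hle
  filter_upwards [eventually_all.2 fun i => Puiseux.eventually_eval_lt (hx i),
    eventually_all.2 fun i => Puiseux.eventually_eval_dotProduct (a i) x] with t h1 h2
  exact ⟨fun j => (x j).eval t, fun i => by rw [← h2 i]; exact h1 i⟩

theorem eventually_nonneg (hP : TropAssumption (polyhedron A b) c) :
    ∀ᶠ t in atTop, ∀ x ∈ polyhedronAt A b t, 0 ≤ x := by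
  have h : ∀ j, ∀ᶠ t in atTop, ∀ x ∈ polyhedronAt A b t, 0 ≤ x j := by
    intro j
    filter_upwards [Puiseux.eventually_implied (A := A) (b := b) (a := -Pi.single j 1) (β := 0)
      ⟨0, hP.zero_mem⟩ fun x hx => by
        rw [neg_dotProduct, single_one_dotProduct]
        exact neg_nonpos.2 (hP.nonneg x hx j)] with t ht x hx
    have := ht x hx
    rw [Puiseux.eval_neg_vec, Puiseux.eval_single, neg_dotProduct, single_one_dotProduct,
      Puiseux.eval_zero] at this
    linarith
  filter_upwards [eventually_all.2 h] with t ht x hx j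
  exact ht j x hx

/-- Each inequality of one representation is implied by the other over the series, hence for large
`t` by Farkas' lemma. The sublevel maxima, defined by `A` and `b`, thus serve every representation.
-/
theorem eventually_eq_polyhedronAt (hP : TropAssumption (polyhedron A b) c) {k : ℕ}
    {A' : Matrix (Fin k) (Fin n) Puiseux} {b' : Fin k → Puiseux}
    (hrep : {x : Fin n → Puiseux | 0 ≤ x ∧ A' *ᵥ x ≤ b'} = polyhedron A b) :
    ∀ᶠ t in atTop, ∀ x : Fin n → ℝ, x ∈ polyhedronAt A b t ↔
      0 ≤ x ∧ A'.map (Puiseux.eval t) *ᵥ x ≤ fun i => (b' i).eval t := by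
  let B : Matrix (Fin k ⊕ Fin n) (Fin n) Puiseux := Sum.elim A' fun j => -Pi.single j 1
  let β : Fin k ⊕ Fin n → Puiseux := Sum.elim b' 0
  have hB : ∀ x, B *ᵥ x ≤ β → x ∈ polyhedron A b := by
    intro x hx
    rw [← hrep]
    refine ⟨fun j => ?_, fun i => hx (Sum.inl i)⟩
    have h1 : (-Pi.single j 1 : Fin n → Puiseux) ⬝ᵥ x ≤ 0 := hx (Sum.inr j)
    rw [neg_dotProduct, single_one_dotProduct] at h1
    exact neg_nonpos.1 h1
  have hB0 : B *ᵥ (0 : Fin n → Puiseux) ≤ β := by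
    have h0 : (0 : Fin n → Puiseux) ∈ {x : Fin n → Puiseux | 0 ≤ x ∧ A' *ᵥ x ≤ b'} :=
      hrep ▸ hP.zero_mem
    have h1 := h0.2
    rw [mulVec_zero] at h1 ⊢
    rintro (i | j)
    · exact h1 i
    · exact le_rfl
  have hrow' : ∀ i, ∀ᶠ t in atTop, ∀ x ∈ polyhedronAt A b t,
      (fun j => (A' i j).eval t) ⬝ᵥ x ≤ (b' i).eval t := fun i =>
    Puiseux.eventually_implied (A := A) (b := b) (a := A' i) (β := b' i) ⟨0, hP.zero_mem⟩
      fun x hx => by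
        have hx' : x ∈ {x : Fin n → Puiseux | 0 ≤ x ∧ A' *ᵥ x ≤ b'} := hrep ▸ hx
        exact hx'.2 i
  have hrow : ∀ i, ∀ᶠ t in atTop, ∀ x : Fin n → ℝ,
      B.map (Puiseux.eval t) *ᵥ x ≤ (fun i => (β i).eval t) →
      (fun j => (A i j).eval t) ⬝ᵥ x ≤ (b i).eval t := fun i =>
    Puiseux.eventually_implied (A := B) (b := β) (a := A i) (β := b i) ⟨0, hB0⟩
      fun x hx => hB x hx i
  filter_upwards [hP.eventually_nonneg, eventually_all.2 hrow', eventually_all.2 hrow]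
    with t h1 h2 h3 x
  refine ⟨fun hx => ⟨h1 x hx, fun i => h2 i x hx⟩, fun ⟨hx, hxA⟩ i => h3 i x ?_⟩
  rintro (i | j)
  · exact hxA i
  · show (fun l => Puiseux.eval t ((-Pi.single j 1 : Fin n → Puiseux) l)) ⬝ᵥ x ≤
      Puiseux.eval t 0
    rw [Puiseux.eval_neg_vec, Puiseux.eval_single, neg_dotProduct, single_one_dotProduct, Puiseux.eval_zero]
    exact neg_nonpos.2 (hx j)

theorem eventually_rhs_nonneg (hP : TropAssumption (polyhedron A b) c) :
    ∀ᶠ t in atTop, 0 ≤ fun i => (b i).eval t := by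
  filter_upwards [eventually_all.2 fun i => Puiseux.eventually_eval_nonneg (hP.rhs_nonneg i)]
    with t ht
  exact ht

theorem eventually_obj_pos {P : Set (Fin n → Puiseux)} (hP : TropAssumption P c) :
    ∀ᶠ t in atTop, ∀ j, 0 < (c j).eval t :=
  eventually_all.2 fun j => Puiseux.eventually_eval_pos (hP.obj_pos j)

/-- For large `t`, the entropic central points exist, are unique, and each of their coordinates is
comparable to its maximum over a sublevel set of the program. -/
theorem eventually_entropic (hP : TropAssumption (polyhedron A b) c) {μ : Puiseux} (hμ : 0 < μ) :
    ∀ᶠ t in atTop, (∃! x, IsEntropicCentralPoint (polyhedronAt A b t) (fun j => (c j).eval t)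
      (μ.eval t) x) ∧
      ∀ x, IsEntropicCentralPoint (polyhedronAt A b t) (fun j => (c j).eval t) (μ.eval t) x →
        x ∈ polyhedronAt A b t ∧ (fun j => (c j).eval t) ⬝ᵥ x ≤ 2 ^ (n + 2) * μ.eval t ∧
        ∀ y ∈ polyhedronAt A b t, (fun j => (c j).eval t) ⬝ᵥ y ≤ μ.eval t →
          ∀ j, y j ≤ 2 ^ (n + 2) * x j := by
  filter_upwards [hP.eventually_nonneg, hP.eventually_rhs_nonneg, hP.eventually_obj_pos,
    Puiseux.eventually_eval_pos hμ,
    hP.eventually_exists_strict (ι := {i // A i ≠ 0}) (fun i => A i.1) (fun i => b i.1)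
      (fun i => Or.inl i.2) (fun i x hx => hx i.1)] with t hnn hb hc hμt ⟨x₀, hx₀⟩
  have hstrict : ∀ i, (A.map (Puiseux.eval t)) i ≠ 0 →
      (A.map (Puiseux.eval t) *ᵥ x₀) i < (b i).eval t := by
    intro i hi
    refine hx₀ ⟨i, fun h0 => hi ?_⟩
    ext j
    show Puiseux.eval t (A i j) = 0
    rw [show A i j = 0 from congrFun h0 j, Puiseux.eval_zero]
  have hpos : (interior (polyhedronAt A b t)).Nonempty :=
    ⟨x₀, mem_interior_polyhedron hb hstrict⟩
  have hmean : gibbsMean (polyhedronAt A b t) (-((μ.eval t)⁻¹ • fun j => (c j).eval t)) ∈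
      interior (polyhedronAt A b t) := gibbsMean_mem_interior hb hnn hstrict fun j =>
    neg_neg_of_pos (mul_pos (inv_pos.2 hμt) (hc j))
  have hPm : MeasurableSet (polyhedronAt A b t) := isClosed_polyhedron.measurableSet
  have hiff := fun x => isEntropicCentralPoint_iff (x := x) hPm hnn hpos hc hμt hmean
  refine ⟨⟨_, (hiff _).2 rfl, fun x hx => (hiff x).1 hx⟩, fun x hx => ?_⟩
  rw [(hiff x).1 hx]
  refine ⟨interior_subset hmean, gibbsMean_bounds hPm convex_polyhedron ?_ hnn hpos hc hμt⟩
  show _ *ᵥ (0 : Fin n → ℝ) ≤ _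
  rw [mulVec_zero]
  exact hb

end TropAssumption

/-! ### Value functions of coordinates and slacks -/

namespace TropAssumption

variable {m n : ℕ} {A : Matrix (Fin m) (Fin n) Puiseux} {b : Fin m → Puiseux}
  {c : Fin n → Puiseux}

theorem exists_coordinate_value (hP : TropAssumption (polyhedron A b) c) (j : Fin n) :
    ∃ F : ℝ → ℝ, Continuous F ∧
      (∃ L : Set (ℝ × ℝ), L.Finite ∧ ∀ lam, ∃ l ∈ L, F lam = lam * l.1 + l.2) ∧
      ∀ μ : Puiseux, 0 < μ → ∃ M : Puiseux, 0 < M ∧ M.exponent = F μ.exponent ∧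
        ∀ᶠ t in atTop, IsGreatest ((fun x => (Pi.single j 1 : Fin n → ℝ) ⬝ᵥ x + 0) ''
          lpSublevel (A.map (Puiseux.eval t)) (fun i => (b i).eval t)
            (fun j => (c j).eval t) (μ.eval t)) (M.eval t) := by
  have hpos : ∃ x, A *ᵥ x ≤ b ∧ 0 < (Pi.single j 1 : Fin n → Puiseux) ⬝ᵥ x + 0 := by
    obtain ⟨x, hx, h⟩ := hP.exists_dotProduct_lt (a := -Pi.single j 1) (β := 0)
      (Or.inl (neg_ne_zero.2 (Pi.single_ne_zero_iff.2 one_ne_zero))) fun x hx => by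
        rw [neg_dotProduct, single_one_dotProduct]
        exact neg_nonpos.2 (hP.nonneg x hx j)
    refine ⟨x, hx, ?_⟩
    rw [neg_dotProduct] at h
    rw [add_zero]
    exact neg_lt_zero.1 h
  obtain ⟨F, hF, hL, hM⟩ := Puiseux.exists_tropical_value A b c (Pi.single j 1) 0 hP.nonneg
    hP.rhs_nonneg hP.obj_pos (fun x hx => by
      rw [single_one_dotProduct, add_zero]; exact hP.nonneg x hx j) hpos
  refine ⟨F, hF, hL, fun μ hμ => ?_⟩
  obtain ⟨M, hM0, hMe, hMt⟩ := hM μ hμ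
  refine ⟨M, hM0, hMe, hMt.mono fun t ht => ?_⟩
  rwa [Puiseux.eval_single, Puiseux.eval_zero] at ht

/-- The value function of the affine functional `β - a ⬝ᵥ x`, positive somewhere on `P` because the
row is nonzero; it gives the limits of the slacks `w`. -/
theorem exists_slack_value (hP : TropAssumption (polyhedron A b) c) {a : Fin n → Puiseux}
    {β : Puiseux} (hne : a ≠ 0 ∨ β ≠ 0) (hle : ∀ x ∈ polyhedron A b, a ⬝ᵥ x ≤ β) :
    ∃ F : ℝ → ℝ, ∀ μ : Puiseux, 0 < μ → ∃ M : Puiseux, 0 < M ∧ M.exponent = F μ.exponent ∧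
      ∀ᶠ t in atTop, IsGreatest
        ((fun x => (-fun l => (a l).eval t : Fin n → ℝ) ⬝ᵥ x + β.eval t) ''
          lpSublevel (A.map (Puiseux.eval t)) (fun i => (b i).eval t)
            (fun j => (c j).eval t) (μ.eval t)) (M.eval t) := by
  obtain ⟨x, hx, h⟩ := hP.exists_dotProduct_lt hne hle
  obtain ⟨F, -, -, hM⟩ := Puiseux.exists_tropical_value A b c (-a) β hP.nonneg
    hP.rhs_nonneg hP.obj_pos (fun x hx => by
      rw [neg_dotProduct, neg_add_eq_sub]; exact sub_nonneg.2 (hle x hx))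
    ⟨x, hx, by rw [neg_dotProduct, neg_add_eq_sub]; exact sub_pos.2 h⟩
  refine ⟨F, fun μ hμ => ?_⟩
  obtain ⟨M, hM0, hMe, hMt⟩ := hM μ hμ
  refine ⟨M, hM0, hMe, hMt.mono fun t ht => ?_⟩
  rwa [Puiseux.eval_neg_vec] at ht

end TropAssumption

/-! ### Proof of the theorem -/

open Matrix in
theorem mainTheorem2 {m n : ℕ} (A : Matrix (Fin m) (Fin n) Puiseux) (b : Fin m → Puiseux)
    (c : Fin n → Puiseux) (hP : TropAssumption (polyhedron A b) c) :
    ∃ X : ℝ → Fin n → ℝ,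
      IsTropicalEntropicPath A b c X ∧
      IsPiecewiseLinear X ∧
      ∀ (k : ℕ) (A' : Matrix (Fin k) (Fin n) Puiseux) (b' : Fin k → Puiseux),
        {x : Fin n → Puiseux | 0 ≤ x ∧ A' *ᵥ x ≤ b'} = polyhedron A b →
        (∀ i, A' i ≠ 0 ∨ b' i ≠ 0) →
        ∃ Z : ℝ → PrimalDual k n,
          IsTropicalLogPath A' b' c Z ∧ ∀ lam : ℝ, (Z lam).x = X lam := by
  -- `F` is built from `A`, `b` and `c` before any representation is chosen, so it serves both
  -- paths.
  choose F hFc hFL hFM using hP.exists_coordinate_value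
  refine ⟨fun lam j => F j lam, ?_, isPiecewiseLinear_of_selection hFc hFL, ?_⟩
  · intro lam μ hμ hval
    obtain ⟨-, rfl⟩ := Puiseux.val_eq_coe_iff.1 hval
    have hent := hP.eventually_entropic hμ
    refine ⟨hent.mono fun t ht => ht.1, fun C hC j => ?_⟩
    obtain ⟨M, hM0, hMe, hMt⟩ := hFM j μ hμ
    simp only
    rw [← hMe]
    refine tendsto_logb_of_comparable (κ := 2 ^ (n + 2)) (Puiseux.eventually_eval_pos hM0) ?_ ?_
      (by positivity) (Puiseux.tendsto_logb_eval hM0)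
    · filter_upwards [hent, hC, hMt] with t h1 h2 h3
      obtain ⟨y, ⟨hy, hcy⟩, hyM⟩ := h3.1
      simp only [single_one_dotProduct, add_zero] at hyM
      rw [← hyM]
      exact (h1.2 _ h2).2.2 y hy hcy j
    · filter_upwards [hent, hC, hMt, hP.eventually_rhs_nonneg] with t h1 h2 h3 h4
      have := le_mul_of_isGreatest_sublevel h4 le_rfl (one_le_pow₀ one_le_two) h3
        (h1.2 _ h2).1 (h1.2 _ h2).2.1
      simpa using this
  · intro k A' b' hrep hne
    have hmem : ∀ x, x ∈ polyhedron A b ↔ 0 ≤ x ∧ A' *ᵥ x ≤ b' := fun x => by rw [← hrep]; rfl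
    have hrow : ∀ i, ∀ x ∈ polyhedron A b, A' i ⬝ᵥ x ≤ b' i := fun i x hx => ((hmem x).1 hx).2 i
    have hb' : 0 ≤ b' := by
      have := ((hmem 0).1 hP.zero_mem).2
      rwa [mulVec_zero] at this
    choose G hG using fun i => hP.exists_slack_value (hne i) (hrow i)
    -- The dual components are forced by `x_j s_j = μ` and `w_i y_i = μ`.
    refine ⟨fun lam => ⟨fun j => F j lam, fun i => G i lam, fun j => lam - F j lam,
      fun i => lam - G i lam⟩, ?_, fun lam => rfl⟩
    intro lam μ hμ hval
    obtain ⟨-, rfl⟩ := Puiseux.val_eq_coe_iff.1 hval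
    have hμt := Puiseux.eventually_eval_pos hμ
    have hb't : ∀ᶠ t in atTop, 0 ≤ fun i => (b' i).eval t :=
      (eventually_all.2 fun i => Puiseux.eventually_eval_nonneg (hb' i)).mono fun t ht => ht
    have heq := hP.eventually_eq_polyhedronAt hrep
    refine ⟨?_, fun C hC => ?_⟩
    · filter_upwards [hμt, hP.eventually_obj_pos,
        -- The rows `-x_j ≤ 0` are included so that the strict point is also positive, as existence
        -- of the central point requires.
        hP.eventually_exists_strict (ι := Fin k ⊕ Fin n)
          (Sum.elim A' fun j => -Pi.single j 1) (Sum.elim b' 0)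
          (by
            rintro (i | j)
            · exact hne i
            · exact Or.inl (neg_ne_zero.2 (Pi.single_ne_zero_iff.2 one_ne_zero)))
          (by
            rintro (i | j) x hx
            · exact hrow i x hx
            · show (-Pi.single j 1 : Fin n → Puiseux) ⬝ᵥ x ≤ 0
              rw [neg_dotProduct, single_one_dotProduct]
              exact neg_nonpos.2 (hP.nonneg x hx j))] with t h1 h2 ⟨x₀, hx₀⟩
      have hx₀j : ∀ j, 0 < x₀ j := fun j => by
        have h3 : (fun l => Puiseux.eval t ((-Pi.single j 1 : Fin n → Puiseux) l)) ⬝ᵥ x₀ <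
            Puiseux.eval t 0 := hx₀ (Sum.inr j)
        rw [Puiseux.eval_neg_vec, Puiseux.eval_single, neg_dotProduct,
          single_one_dotProduct, Puiseux.eval_zero] at h3
        linarith
      obtain ⟨z, hz⟩ := exists_isLogCentralPoint (A := A'.map (Puiseux.eval t))
        (b := fun i => (b' i).eval t) h2 h1 hx₀j fun i => hx₀ (Sum.inl i)
      exact ⟨z, hz, fun z' hz' => hz'.unique h1 hz⟩
    · have hκ : (0 : ℝ) < n + k + 1 := by positivity
      have hκ1 : (1 : ℝ) ≤ n + k + 1 := le_add_of_nonneg_left (by positivity)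
      have hfeas : ∀ᶠ t in atTop, (C t).x ∈ polyhedronAt A b t ∧
          (fun j => (c j).eval t) ⬝ᵥ (C t).x ≤ (n + k + 1) * μ.eval t := by
        filter_upwards [hC, heq, hb't, hμt] with t h1 h2 h3 h4
        refine ⟨(h2 _).2 ⟨fun j => (h1.x_pos j).le, ?_⟩, ?_⟩
        · rw [← sub_nonneg, h1.w_eq]
          exact fun i => (h1.w_pos i).le
        · have := h1.dotProduct_le h3
          linarith
      have hx : ∀ j, Tendsto (fun t => Real.logb t ((C t).x j)) atTop
          (𝓝 (F j μ.exponent)) := by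
        intro j
        obtain ⟨M, hM0, hMe, hMt⟩ := hFM j μ hμ
        rw [← hMe]
        refine tendsto_logb_of_comparable (κ := n + k + 1) (Puiseux.eventually_eval_pos hM0) ?_ ?_
          hκ (Puiseux.tendsto_logb_eval hM0)
        · filter_upwards [hC, heq, hMt, hP.eventually_obj_pos] with t h1 h2 h3 h4
          obtain ⟨y, ⟨hy, hcy⟩, hyM⟩ := h3.1
          simp only [single_one_dotProduct, add_zero] at hyM
          rw [← hyM]
          obtain ⟨hy0, hyA⟩ := (h2 y).1 hy
          exact (h1.le_mul (fun j => (h4 j).le) hy0 hyA hcy).1 j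
        · filter_upwards [hfeas, hMt, hP.eventually_rhs_nonneg] with t h1 h2 h3
          simpa using le_mul_of_isGreatest_sublevel h3 le_rfl hκ1 h2 h1.1 h1.2
      have hw : ∀ i, Tendsto (fun t => Real.logb t ((C t).w i)) atTop
          (𝓝 (G i μ.exponent)) := by
        intro i
        obtain ⟨M, hM0, hMe, hMt⟩ := hG i μ hμ
        rw [← hMe]
        refine tendsto_logb_of_comparable (κ := n + k + 1) (Puiseux.eventually_eval_pos hM0) ?_ ?_
          hκ (Puiseux.tendsto_logb_eval hM0)
        · filter_upwards [hC, heq, hMt, hP.eventually_obj_pos] with t h1 h2 h3 h4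
          obtain ⟨y, ⟨hy, hcy⟩, hyM⟩ := h3.1
          simp only [neg_dotProduct, neg_add_eq_sub] at hyM
          rw [← hyM]
          obtain ⟨hy0, hyA⟩ := (h2 y).1 hy
          exact (h1.le_mul (fun j => (h4 j).le) hy0 hyA hcy).2 i
        · filter_upwards [hfeas, hMt, hP.eventually_rhs_nonneg, hb't, hC] with t h1 h2 h3 h4 h5
          have := le_mul_of_isGreatest_sublevel h3 (h4 i) hκ1 h2 h1.1 h1.2
          rw [neg_dotProduct, neg_add_eq_sub] at this
          rw [← h5.w_eq]
          exact this
      have hμl := Puiseux.tendsto_logb_eval hμ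
      refine ⟨hx, hw, fun j => (hμl.sub (hx j)).congr' ?_, fun i => (hμl.sub (hw i)).congr' ?_⟩
      · filter_upwards [hC] with t h1
        rw [← h1.compl_x j, Real.logb_mul (h1.x_pos j).ne' (h1.s_pos j).ne', add_sub_cancel_left]
      · filter_upwards [hC] with t h1
        rw [← h1.compl_w i, Real.logb_mul (h1.w_pos i).ne' (h1.y_pos i).ne', add_sub_cancel_left]
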